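/- Let $\rho:\mathrm{SL}_2(\mathbb Z)\to \mathrm{GL}_d(\mathbb C)$ be a representation with $\rho(-1)=1$ such that $\rho\begin{pmatrix}1&1\\0&1\end{pmatrix}=\exp(2\pi i\Lambda)$ for a diagonal matrix $\Lambda$ with rational entries. Let $\mathcal M(\rho)$ be the space of holomorphic maps $X:\mathbf H\to\mathbb C^d$ on the upper half-plane with $X(\gamma\tau)=\rho(\gamma)X(\tau)$ for all $\gamma\in \mathrm{SL}_2(\mathbb Z)$, whose expansion $q^{-\Lambda}X(\tau)=\sum_{n\in\mathbb Z}X[n]q^n$, $q=e^{2\pi i\tau}$, has only finitely many nonzero terms with $n<0$; the sum of these terms is the principal part $\mathcal P X$. Assume that $\Lambda$ is chosen such that the principal part map $\mathcal P$ from $\mathcal M(\rho)$ to the finite sums $\sum_{n<0}p[n]q^n$, $p[n]\in\mathbb C^d$, is bijective. For $1\le\eta\le d$ let $X^{(\eta)}\in\mathcal M(\rho)$ be the element with principal part $q^{-1}e_\eta$ (where $e_\eta$ is the $\eta$-th standard basis vector), and put $$\Xi(\tau)_{\xi\eta}=X^{(\eta)}(\tau)_\xi,\qquad \mathcal X_{\xi\eta}=X^{(\eta)}[0]_\xi,$$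 $$\mathcal A=\tfrac{31}{36}(1-\Lambda)-\tfrac1{864}\bigl(\mathcal X+[\Lambda,\mathcal X]\bigr),\qquad \mathcal B=\tfrac{41}{24}(1-\Lambda)+\tfrac1{576}\bigl(\mathcal X+[\Lambda,\mathcal X]\bigr).$$ Let $\alpha$ be the algebraic multiplicity of the eigenvalue $1$ of $\mathcal A$, and let $\beta_1,\beta_2$ be the algebraic multiplicities of the eigenvalues $1$ and $2$ of $\mathcal B$. Then $$\alpha=\mathrm{Tr}\,\mathcal A,\qquad \beta_1=2\,\mathrm{Tr}\,\mathcal B-\mathrm{Tr}\,\mathcal B^2,\qquad \beta_2=\tfrac12\bigl(\mathrm{Tr}\,\mathcal B^2-\mathrm{Tr}\,\mathcal B\bigr),$$ and for all $\tau\in\mathbf H$ $$\det\Xi(\tau)=\left(\frac{E_4(\tau)}{\Delta(\tau)^{1/3}}\right)^{\beta_1+2\beta_2}\left(\frac{E_6(\tau)}{\Delta(\tau)^{1/2}}\right)^{\alpha},$$ where $E_4,E_6$ are the normalized Eisenstein series, $\Delta=\eta^{24}$ with $\eta$ the Dedekind eta function, $\Delta^{1/3}=\eta^8$ and $\Delta^{1/2}=\eta^{12}$.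 Consequently the fundamental matrix $\Xi(\tau)$ is invertible at every $\tau$ that is not an elliptic point, i.e. lies neither in the $\mathrm{SL}_2(\mathbb Z)$-orbit of $i$ nor in that of $e^{2\pi i/3}$. At $\tau$ in the orbit of $i$ it is invertible if and only if $\alpha=0$, and invertibility there implies $\rho\begin{pmatrix}0&-1\\1&0\end{pmatrix}=1$; at $\tau$ in the orbit of $e^{2\pi i/3}$ it is invertible if and only if $\beta_1=\beta_2=0$, and invertibility there implies $\rho\begin{pmatrix}0&-1\\1&-1\end{pmatrix}=1$. -/

import Mathlib

open scoped MatrixGroups UpperHalfPlane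

namespace VVMF

/-- `Λ` (a rational diagonal matrix, given by its diagonal entries) is an exponent matrix of `ρ`:
`ρ(1 1; 0 1) = exp(2πiΛ)`. In particular `ρ(1 1; 0 1)` is diagonal of finite order. -/
def IsExponentMatrix {d : ℕ} (ρ : SL(2, ℤ) →* GL (Fin d) ℂ) (Λ : Fin d → ℚ) : Prop :=
  (ρ ModularGroup.T : Matrix (Fin d) (Fin d) ℂ) =
    Matrix.diagonal fun ξ => Complex.exp (2 * Real.pi * Complex.I * (Λ ξ : ℂ))

/-- `q^{-Λ} X(τ) = ∑_{n ∈ ℤ} c[n] q^n` on the upper half-plane, where `q^s = exp(2πisτ)`. -/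
def HasQExpansion {d : ℕ} (Λ : Fin d → ℚ) (X : ℍ → Fin d → ℂ) (c : ℤ → Fin d → ℂ) : Prop :=
  ∀ (τ : ℍ) (ξ : Fin d),
    HasSum (fun n : ℤ => c n ξ * Complex.exp (2 * Real.pi * Complex.I * (n : ℂ) * (τ : ℂ)))
      (Complex.exp (-(2 * Real.pi * Complex.I * (Λ ξ : ℂ) * (τ : ℂ))) * X τ ξ)

/-- The coefficients of a `q`-expansion are determined by the function. -/
theorem HasQExpansion.unique {d : ℕ} {Λ : Fin d → ℚ} {X : ℍ → Fin d → ℂ}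
    {c c' : ℤ → Fin d → ℂ} (h : HasQExpansion Λ X c) (h' : HasQExpansion Λ X c') : c = c' := by
  funext m ξ
  set b : ℤ → ℂ := fun n => (c n ξ - c' n ξ) * Complex.exp (-(2 * Real.pi * (n : ℂ))) with hb
  have key : ∀ x : ℝ, HasSum
      (fun n : ℤ => b n * Complex.exp (2 * Real.pi * Complex.I * (n : ℂ) * (x : ℂ))) 0 := by
    intro x
    have hx := (h ⟨(x : ℂ) + Complex.I, by simp⟩ ξ).sub (h' ⟨(x : ℂ) + Complex.I, by simp⟩ ξ)
    rw [sub_self] at hx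
    refine hx.congr_fun ?_
    intro n
    simp only [hb]
    rw [← sub_mul, mul_assoc, ← Complex.exp_add]
    congr 2
    linear_combination (-2 * Real.pi * (n : ℂ)) * Complex.I_sq
  have hs : Summable fun n : ℤ => ‖b n‖ := by
    have := (key 0).summable.norm
    simpa using this
  have hbm0 : b m = 0 → c m ξ = c' m ξ := fun hbm =>
    sub_eq_zero.mp ((mul_eq_zero.mp hbm).resolve_right (Complex.exp_ne_zero _))
  clear_value b
  have hint : HasSum (fun n : ℤ => ∫ x in (0 : ℝ)..1, b n *
      Complex.exp (2 * Real.pi * Complex.I * ((n - m : ℤ) : ℂ) * (x : ℂ)))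
      (∫ x in (0 : ℝ)..1, (0 : ℂ)) := by
    refine intervalIntegral.hasSum_integral_of_dominated_convergence (fun n _ => ‖b n‖) ?_ ?_ ?_ ?_ ?_
    · intro n
      exact Continuous.aestronglyMeasurable (by fun_prop)
    · intro n
      refine Filter.Eventually.of_forall fun x _ => ?_
      rw [norm_mul, show 2 * Real.pi * Complex.I * ((n - m : ℤ) : ℂ) * (x : ℂ)
        = ((2 * Real.pi * ((n - m : ℤ) : ℝ) * x : ℝ) : ℂ) * Complex.I by push_cast; ring,
        Complex.norm_exp_ofReal_mul_I, mul_one]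
    · exact Filter.Eventually.of_forall fun x _ => hs
    · simp
    · refine Filter.Eventually.of_forall fun x _ => ?_
      have := (key x).mul_right
        (Complex.exp (-(2 * Real.pi * Complex.I * (m : ℂ) * (x : ℂ))))
      rw [zero_mul] at this
      refine this.congr_fun ?_
      intro n
      rw [mul_assoc (b n), ← Complex.exp_add]
      congr 2
      push_cast
      ring
  have hzero : ∀ n : ℤ, n ≠ m → (∫ x in (0 : ℝ)..1, b n *
      Complex.exp (2 * Real.pi * Complex.I * ((n - m : ℤ) : ℂ) * (x : ℂ))) = 0 := by
    intro n hn
    have hne : (2 * Real.pi * Complex.I * ((n - m : ℤ) : ℂ)) ≠ 0 := by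
      refine mul_ne_zero Complex.two_pi_I_ne_zero ?_
      exact_mod_cast sub_ne_zero.mpr hn
    rw [intervalIntegral.integral_const_mul, integral_exp_mul_complex hne, Complex.ofReal_one,
      Complex.ofReal_zero, mul_one, mul_zero, Complex.exp_zero]
    have : Complex.exp (2 * Real.pi * Complex.I * ((n - m : ℤ) : ℂ)) = 1 := by
      rw [mul_comm]; exact Complex.exp_int_mul_two_pi_mul_I _
    rw [this, sub_self, zero_div, mul_zero]
  have hval := hint.unique (hasSum_single m hzero)
  exact hbm0 (by simpa using hval.symm)

open Classical in
/-- The coefficients `X[n]` of the `q`-expansion of `X` relative to `Λ`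
(zero if there is no such expansion). -/
noncomputable def qCoeff {d : ℕ} (Λ : Fin d → ℚ) (X : ℍ → Fin d → ℂ) : ℤ → Fin d → ℂ :=
  if h : ∃ c, HasQExpansion Λ X c then h.choose else 0

theorem HasQExpansion.qCoeff_eq {d : ℕ} {Λ : Fin d → ℚ} {X : ℍ → Fin d → ℂ}
    {c : ℤ → Fin d → ℂ} (h : HasQExpansion Λ X c) : qCoeff Λ X = c := by
  have h' : ∃ c, HasQExpansion Λ X c := ⟨c, h⟩
  rw [qCoeff, dif_pos h']
  exact h'.choose_spec.unique h

/-- The space `M(ρ)` of vector-valued modular functions for `ρ`: holomorphic on the upper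
half-plane, transforming according to `ρ`, with only finite order poles at the cusps. -/
def vvModularFunctions {d : ℕ} (ρ : SL(2, ℤ) →* GL (Fin d) ℂ) : Set (ℍ → Fin d → ℂ) :=
  {X | (∀ ξ, MDifferentiable (modelWithCornersSelf ℂ ℂ) (modelWithCornersSelf ℂ ℂ)
          fun τ : ℍ => X τ ξ) ∧
    (∀ (γ : SL(2, ℤ)) (τ : ℍ),
      X (γ • τ) = Matrix.mulVec (ρ γ : Matrix (Fin d) (Fin d) ℂ) (X τ)) ∧
    ∃ Λ : Fin d → ℚ, IsExponentMatrix ρ Λ ∧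
      ∃ c, HasQExpansion Λ X c ∧ {n : ℤ | n < 0 ∧ c n ≠ 0}.Finite}

/-- The principal part of `X` relative to `Λ`, i.e. the part `∑_{n < 0} X[n] q^n` of its
`q`-expansion, encoded by its family of coefficients. -/
noncomputable def principalPart {d : ℕ} (Λ : Fin d → ℚ) (X : ℍ → Fin d → ℂ) : ℤ → Fin d → ℂ :=
  fun n => if n < 0 then qCoeff Λ X n else 0

/-- All possible principal parts: finite sums `∑_{n < 0} p[n] q^n` with `p[n] ∈ ℂ^d`. -/
def principalParts (d : ℕ) : Set (ℤ → Fin d → ℂ) :=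
  {p | {n | p n ≠ 0}.Finite ∧ ∀ n, 0 ≤ n → p n = 0}

/-- The principal part map of `M(ρ)` relative to `Λ` is invertible. -/
def PrincipalPartInvertible {d : ℕ} (ρ : SL(2, ℤ) →* GL (Fin d) ℂ) (Λ : Fin d → ℚ) : Prop :=
  Set.BijOn (principalPart Λ) (vvModularFunctions ρ) (principalParts d)

/-- The canonical basis vector `X^(ξ;n)`: the element of `M(ρ)` whose principal part relative
to `Λ` is `q^{-n}` at the position `ξ` and zero elsewhere (meaningful if the principal part map
is invertible and `n > 0`). -/
noncomputable def canonicalBasisVector {d : ℕ} (ρ : SL(2, ℤ) →* GL (Fin d) ℂ) (Λ : Fin d → ℚ)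
    (ξ : Fin d) (n : ℤ) : ℍ → Fin d → ℂ :=
  Function.invFunOn (principalPart Λ) (vvModularFunctions ρ)
    fun m η => if m = -n ∧ η = ξ then 1 else 0

/-- The fundamental matrix `Ξ(τ)`, whose columns are the canonical basis vectors `X^(η;1)`. -/
noncomputable def fundamentalMatrix {d : ℕ} (ρ : SL(2, ℤ) →* GL (Fin d) ℂ) (Λ : Fin d → ℚ)
    (τ : ℍ) : Matrix (Fin d) (Fin d) ℂ :=
  Matrix.of fun ξ η => canonicalBasisVector ρ Λ η 1 τ ξ

/-- The characteristic matrix `𝒳`: the entry `(ξ, η)` is the constant part `X^(η;1)[0]_ξ`. -/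
noncomputable def characteristicMatrix {d : ℕ} (ρ : SL(2, ℤ) →* GL (Fin d) ℂ) (Λ : Fin d → ℚ) :
    Matrix (Fin d) (Fin d) ℂ :=
  Matrix.of fun ξ η => qCoeff Λ (canonicalBasisVector ρ Λ η 1) 0 ξ

/-- The exponent matrix as a complex diagonal matrix. -/
noncomputable def exponentMatrix {d : ℕ} (Λ : Fin d → ℚ) : Matrix (Fin d) (Fin d) ℂ :=
  Matrix.diagonal fun ξ => (Λ ξ : ℂ)

/-- `𝒳 + [Λ, 𝒳]`. -/
noncomputable def shiftedCharacteristicMatrix {d : ℕ} (ρ : SL(2, ℤ) →* GL (Fin d) ℂ)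
    (Λ : Fin d → ℚ) : Matrix (Fin d) (Fin d) ℂ :=
  characteristicMatrix ρ Λ + (exponentMatrix Λ * characteristicMatrix ρ Λ
    - characteristicMatrix ρ Λ * exponentMatrix Λ)

/-- `𝒜 = 31/36 (1 - Λ) - 1/864 (𝒳 + [Λ, 𝒳])`. -/
noncomputable def matrixA {d : ℕ} (ρ : SL(2, ℤ) →* GL (Fin d) ℂ) (Λ : Fin d → ℚ) :
    Matrix (Fin d) (Fin d) ℂ :=
  (31 / 36 : ℂ) • (1 - exponentMatrix Λ) - (1 / 864 : ℂ) • shiftedCharacteristicMatrix ρ Λ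

/-- `ℬ = 41/24 (1 - Λ) + 1/576 (𝒳 + [Λ, 𝒳])`. -/
noncomputable def matrixB {d : ℕ} (ρ : SL(2, ℤ) →* GL (Fin d) ℂ) (Λ : Fin d → ℚ) :
    Matrix (Fin d) (Fin d) ℂ :=
  (41 / 24 : ℂ) • (1 - exponentMatrix Λ) + (1 / 576 : ℂ) • shiftedCharacteristicMatrix ρ Λ

/-- `α`, the multiplicity of the eigenvalue `1` of `𝒜`. -/
noncomputable def sigAlpha {d : ℕ} (ρ : SL(2, ℤ) →* GL (Fin d) ℂ) (Λ : Fin d → ℚ) : ℕ :=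
  (matrixA ρ Λ).charpoly.rootMultiplicity 1

/-- `β₁`, the multiplicity of the eigenvalue `1` of `ℬ`. -/
noncomputable def sigBeta₁ {d : ℕ} (ρ : SL(2, ℤ) →* GL (Fin d) ℂ) (Λ : Fin d → ℚ) : ℕ :=
  (matrixB ρ Λ).charpoly.rootMultiplicity 1

/-- `β₂`, the multiplicity of the eigenvalue `2` of `ℬ`. -/
noncomputable def sigBeta₂ {d : ℕ} (ρ : SL(2, ℤ) →* GL (Fin d) ℂ) (Λ : Fin d → ℚ) : ℕ :=
  (matrixB ρ Λ).charpoly.rootMultiplicity 2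

/-- `Δ^{1/3} = η^8 = q^{1/3} ∏_{n ≥ 1} (1 - q^n)^8`, where `Δ = η^24`. -/
noncomputable def deltaThird (τ : ℍ) : ℂ := ModularForm.eta (τ : ℂ) ^ 8

/-- `Δ^{1/2} = η^12 = q^{1/2} ∏_{n ≥ 1} (1 - q^n)^12`, where `Δ = η^24`. -/
noncomputable def deltaHalf (τ : ℍ) : ℂ := ModularForm.eta (τ : ℂ) ^ 12

/-- The `SL₂(ℤ)`-orbit of `i`. -/
def ellipticPointsI : Set ℍ := MulAction.orbit SL(2, ℤ) UpperHalfPlane.I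

/-- The `SL₂(ℤ)`-orbit of `exp(2πi/3) = -1/2 + i√3/2`. -/
def ellipticPointsRho : Set ℍ := MulAction.orbit SL(2, ℤ) UpperHalfPlane.ρ

end VVMF

namespace VVMF

open UpperHalfPlane hiding I
open Filter Topology Complex ModularForm EisensteinSeries Derivative
open scoped Manifold Real Matrix

/-! Write `C` for `𝒳 + [Λ, 𝒳]` and `D = q d/dq`. The operator `(E₄E₆/Δ) D` has weight zero, hence
maps `M(ρ)` to itself. Injectivity of the principal part map expresses its values on the columns of
`Ξ` through `Ξ`, which gives the first order equation `E₄E₆ DΞ = Ξ ((E₄³ - 984Δ)(Λ - 1) + ΔC)`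
(`fundamentalMatrix_ode`).

At `i` the left side vanishes and `E₄³ = 1728Δ`, so the coefficient matrix on the right is a
multiple of `𝒜`; at `e^{2πi/3}`, where `E₄ = 0`, it is a multiple of `ℬ`. Comparing Taylor
coefficients there shows that the rows of `Ξ` and `DΞ` at `i` are left eigenvectors of `𝒜` for `0`
and `1` (or zero), and that the rows of `Ξ`, `DΞ`, `D²Ξ` at `e^{2πi/3}` are, up to a triangular
correction, left eigenvectors of `ℬ` for `0`, `1`, `2`.

These rows have no common kernel. If `Ξv` vanishes to second order at `i`, it is `E₆² h` with `h` of
weight `-12`; then `Δh` has weight `0` and no principal part, so `h = 0` and `v = 0`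
(`eq_zero_of_vanish_I`). Third order at `e^{2πi/3}` and `E₄³` work the same way
(`eq_zero_of_vanish_ρ`). Hence the eigenvalues lie in `{0, 1}` and `{0, 1, 2}`, and the traces of
`𝒜`, `ℬ` and `ℬ²` determine the multiplicities.

Jacobi's formula turns the equation into a scalar one for `det Ξ` (`det_ode`), which the product of
powers of `E₄/η⁸` and `E₆/η¹²` also solves by Ramanujan's identities. The two solutions are
proportional and have the same leading term at the cusp, so they agree (`det_fundamentalMatrix`).
Invertibility is then read off from the zeros of `E₄` and `E₆`, and invertibility at a fixed point
of `γ` forces `ρ(γ) = 1` by cancelling `Ξ` in the transformation law. -/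

/-! ### Expansions at the cusp -/

/-- The local parameter `q = e^{2πiτ}` at the cusp. -/
noncomputable abbrev qq (τ : ℍ) : ℂ := Function.Periodic.qParam 1 (τ : ℂ)

theorem norm_qq_lt_one (τ : ℍ) : ‖qq τ‖ < 1 :=
  Function.Periodic.norm_qParam_lt_one one_pos τ.im_pos

theorem qq_ne_zero (τ : ℍ) : qq τ ≠ 0 := Function.Periodic.qParam_ne_zero _

theorem qq_eq_exp (τ : ℍ) : qq τ = exp (2 * π * I * τ) := by
  simp [qq, Function.Periodic.qParam]

theorem tendsto_qq : Tendsto qq atImInfty (𝓝 0) := qParam_tendsto_atImInfty one_pos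

theorem hasDerivAt_qParam (z : ℂ) :
    HasDerivAt (Function.Periodic.qParam 1) (2 * π * I * Function.Periodic.qParam 1 z) z := by
  have h : HasDerivAt (fun z : ℂ => exp (2 * π * I * z / (1 : ℝ)))
      (exp (2 * π * I * z / (1 : ℝ)) * (2 * π * I * 1 / (1 : ℝ))) z :=
    (((hasDerivAt_id z).const_mul _).div_const _).cexp
  convert! h using 1
  simp [Function.Periodic.qParam]
  ring

/-- `D` of a power series in `q`. -/
theorem D_eq_of_comp_qq {f : ℍ → ℂ} {F : ℂ → ℂ} (hF : DifferentiableOn ℂ F (Metric.ball 0 1))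
    (h : ∀ τ, f τ = F (qq τ)) (τ : ℍ) : D f τ = qq τ * deriv F (qq τ) := by
  have hq : DifferentiableAt ℂ F (qq τ) :=
    hF.differentiableAt (Metric.isOpen_ball.mem_nhds (by simpa using norm_qq_lt_one τ))
  have h1 := hq.hasDerivAt.comp (τ : ℂ) (hasDerivAt_qParam τ)
  have h2 : f ∘ ofComplex =ᶠ[𝓝 (τ : ℂ)] F ∘ Function.Periodic.qParam 1 := by
    filter_upwards [isOpen_upperHalfPlaneSet.mem_nhds τ.im_pos] with z hz
    simp [ofComplex_apply_of_im_pos hz, h, qq]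
  rw [normalizedDerivOfComplex, h2.deriv_eq, h1.deriv]
  field_simp [Complex.two_pi_I_ne_zero, Real.pi_ne_zero]

/-- Functions of `q` that are holomorphic on the unit disc. -/
structure IsCuspHolo (f : ℍ → ℂ) (F : ℂ → ℂ) : Prop where
  diff : DifferentiableOn ℂ F (Metric.ball 0 1)
  eq : ∀ τ, f τ = F (qq τ)

namespace IsCuspHolo

variable {f : ℍ → ℂ} {F : ℂ → ℂ}

theorem analyticAt (h : IsCuspHolo f F) : AnalyticAt ℂ F 0 :=
  h.diff.analyticAt (Metric.isOpen_ball.mem_nhds (by simp))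

theorem tendsto (h : IsCuspHolo f F) : Tendsto f atImInfty (𝓝 (F 0)) := by
  have := h.analyticAt.continuousAt.tendsto.comp tendsto_qq
  exact this.congr fun τ => (h.eq τ).symm

theorem D_eq (h : IsCuspHolo f F) (τ : ℍ) : D f τ = qq τ * deriv F (qq τ) :=
  D_eq_of_comp_qq h.diff h.eq τ

theorem tendsto_D (h : IsCuspHolo f F) : Tendsto (D f) atImInfty (𝓝 0) := by
  have := tendsto_qq.mul (h.analyticAt.deriv.continuousAt.tendsto.comp tendsto_qq)
  rw [zero_mul] at this
  exact this.congr fun τ => (h.D_eq τ).symm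

end IsCuspHolo

theorem isCuspHolo_of_bounded {f : ℍ → ℂ} (hper : Function.Periodic (f ∘ ofComplex) 1)
    (hf : MDiff f) (hb : IsBoundedAtImInfty f) : IsCuspHolo f (cuspFunction 1 f) :=
  ⟨differentiableOn_cuspFunction_ball one_pos (by simpa using hper) hf hb,
    fun τ => (eq_cuspFunction τ one_ne_zero (by simpa using hper)).symm⟩

theorem periodic_comp_ofComplex_of_vadd {f : ℍ → ℂ} (h : ∀ τ : ℍ, f ((1 : ℝ) +ᵥ τ) = f τ) :
    Function.Periodic (f ∘ ofComplex) 1 := by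
  intro w
  by_cases! hw : 0 < im w
  · have hw' : 0 < im (w + 1) := by simpa using hw
    simp only [Function.comp_apply, ofComplex_apply_of_im_pos hw, ofComplex_apply_of_im_pos hw']
    rw [← h ⟨w, hw⟩]
    congr 1
    ext
    simp [add_comm]
  · have : im (w + 1) ≤ 0 := by simpa using hw
    simp [ofComplex_apply_of_im_nonpos this, ofComplex_apply_of_im_nonpos hw]

theorem isCuspHolo_of_hasSum {f : ℍ → ℂ} {c : ℕ → ℂ} (hper : Function.Periodic (f ∘ ofComplex) 1)
    (hf : MDiff f)
    (hs : ∀ τ : ℍ, HasSum (fun m => c m • Function.Periodic.qParam (1 : ℝ) τ ^ m) (f τ)) :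
    IsCuspHolo f (cuspFunction 1 f) ∧ cuspFunction 1 f 0 = c 0 ∧
      deriv (cuspFunction 1 f) 0 = c 1 := by
  have h := isCuspHolo_of_bounded hper hf (isBoundedAtImInfty_of_hasSum_qExpansion one_pos hs)
  have hp := (hasFPowerSeriesOnBall_cuspFunction one_pos h.analyticAt hs).hasFPowerSeriesAt
  refine ⟨h, ?_, ?_⟩
  · simpa using (hp.coeff_zero ![]).symm
  · simpa [FormalMultilinearSeries.coeff_ofScalars] using hp.deriv

theorem isCuspHolo_modularForm {k : ℤ} (f : ModularForm 𝒮ℒ k) :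
    IsCuspHolo f (cuspFunction 1 f) :=
  ⟨fun _ hz => (ModularFormClass.differentiableAt_cuspFunction f one_pos one_mem_strictPeriods_SL
      (by simpa using hz)).differentiableWithinAt,
    fun τ => (SlashInvariantFormClass.eq_cuspFunction f τ one_mem_strictPeriods_SL
      one_ne_zero).symm⟩

theorem cuspFunction_coeff_zero (f : ℍ → ℂ) : cuspFunction 1 f 0 = (qExpansion 1 f).coeff 0 := by
  simp [qExpansion_coeff]

theorem cuspFunction_coeff_one (f : ℍ → ℂ) :
    deriv (cuspFunction 1 f) 0 = (qExpansion 1 f).coeff 1 := by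
  simp [qExpansion_coeff]

/-! ### Ramanujan's identities and the derivatives of `η` and `Δ` -/

theorem tendsto_E₄ : Tendsto E₄ atImInfty (𝓝 1) := by
  have := (isCuspHolo_modularForm E₄).tendsto
  rwa [cuspFunction_coeff_zero, E_qExpansion_coeff_zero _ ⟨2, rfl⟩] at this

theorem tendsto_E₆ : Tendsto E₆ atImInfty (𝓝 1) := by
  have := (isCuspHolo_modularForm E₆).tendsto
  rwa [cuspFunction_coeff_zero, E_qExpansion_coeff_zero _ ⟨3, rfl⟩] at this

theorem mdiff_E₄ : MDiff E₄ := ModularFormClass.holo E₄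
theorem mdiff_E₆ : MDiff E₆ := ModularFormClass.holo E₆
theorem mdiff_discriminant : MDiff discriminant := ModularFormClass.holo CuspForm.discriminant

theorem tendsto_E2 : Tendsto E2 atImInfty (𝓝 1) := by
  have hper : Function.Periodic (E2 ∘ ofComplex) 1 := by
    apply periodic_comp_ofComplex_of_vadd
    intro τ
    rw [E2_eq_tsum_cexp, E2_eq_tsum_cexp]
    have : cexp (2 * π * I * ((1 : ℝ) +ᵥ τ : ℍ)) = cexp (2 * π * I * τ) := by
      rw [coe_vadd, mul_add, Complex.exp_add]
      simp
    simp only [this]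
  have hs : ∀ τ : ℍ, HasSum (fun n : ℕ => (if n = 0 then 1 else
      -24 * (ArithmeticFunction.sigma 1 n : ℂ)) • Function.Periodic.qParam (1 : ℝ) τ ^ n)
      (E2 τ) := fun τ => by
    simpa only [Function.Periodic.qParam, ofReal_one, div_one] using hasSum_qExpansion_E2 (z := τ)
  obtain ⟨h, h0, -⟩ := isCuspHolo_of_hasSum hper E2_mdifferentiable hs
  simpa [h0] using h.tendsto

/-- The Serre derivative is slash invariant. It is bounded at the cusp since `D f → 0` and `E2 → 1`
there, and invariance carries this bound to every other cusp. -/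
theorem serreDerivative_modular {k : ℤ} (f : ModularForm 𝒮ℒ k) :
    ∃ g : ModularForm 𝒮ℒ (k + 2), (g : ℍ → ℂ) = serreDerivative k f := by
  have hb : IsBoundedAtImInfty (serreDerivative k f) := by
    have h := ((isCuspHolo_modularForm f).tendsto_D).sub
      ((tendsto_E2.const_mul ((k : ℂ) * 12⁻¹)).mul (isCuspHolo_modularForm f).tendsto)
    exact h.isBigO_one ℝ
  have hsl : ∀ γ : SL(2, ℤ), serreDerivative k f ∣[k + 2] γ = serreDerivative k f := fun γ =>
    serreDerivative_slash_invariant (ModularFormClass.holo f)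
      (SlashInvariantFormClass.slash_action_eq f _ ⟨γ, rfl⟩)
  refine ⟨{ toFun := serreDerivative k f
            slash_action_eq' := ?_
            holo' := serreDerivative_mdifferentiable _ (ModularFormClass.holo f)
            bdd_at_cusps' := ?_ }, rfl⟩
  · rintro A ⟨γ, rfl⟩
    exact hsl γ
  · intro c hc
    rw [Subgroup.IsArithmetic.isCusp_iff_isCusp_SL2Z] at hc
    rw [OnePoint.isBoundedAt_iff_forall_SL2Z hc]
    intro γ _
    rw [hsl γ]
    exact hb

/-- In a one-dimensional space of forms the value at the cusp determines the form. Ramanujan's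
identities thus reduce to comparing constant terms in weights 6 and 8. -/
theorem exists_smul_eq_of_rank_one {k : ℤ} (h : Module.rank ℂ (ModularForm 𝒮ℒ k) = 1)
    {e : ModularForm 𝒮ℒ k} (he : Tendsto e atImInfty (𝓝 1)) (f : ModularForm 𝒮ℒ k) {c : ℂ}
    (hf : Tendsto f atImInfty (𝓝 c)) (τ : ℍ) : f τ = c * e τ := by
  have he0 : e ≠ 0 := by
    rintro rfl
    have h0 : Tendsto (fun _ : ℍ => (0 : ℂ)) atImInfty (𝓝 0) := tendsto_const_nhds
    exact zero_ne_one (tendsto_nhds_unique h0 he)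
  obtain ⟨d, hd⟩ := (finrank_eq_one_iff_of_nonzero' e he0).mp
    (Module.rank_eq_one_iff_finrank_eq_one.mp h) f
  have hd' : ∀ τ, f τ = d * e τ := fun τ => by rw [← hd]; rfl
  have := tendsto_nhds_unique hf ((he.const_mul d).congr fun τ => (hd' τ).symm)
  rw [hd' τ, this, mul_one]

/-- Ramanujan's identity for `E₄`. -/
theorem D_E₄ (τ : ℍ) : D E₄ τ = (E2 τ * E₄ τ - E₆ τ) / 3 := by
  obtain ⟨g, hg⟩ := serreDerivative_modular E₄
  have ht : Tendsto g atImInfty (𝓝 (-1 / 3)) := by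
    rw [hg]
    have h := ((isCuspHolo_modularForm E₄).tendsto_D).sub
      ((tendsto_E2.const_mul (((4 : ℕ) : ℤ) * 12⁻¹ : ℂ)).mul tendsto_E₄)
    convert! h using 2
    norm_num
  have := exists_smul_eq_of_rank_one levelOne_weight_six_rank_one tendsto_E₆ g ht τ
  rw [hg, serreDerivative_apply] at this
  push_cast at this
  linear_combination this

/-- Ramanujan's identity for `E₆`. -/
theorem D_E₆ (τ : ℍ) : D E₆ τ = (E2 τ * E₆ τ - E₄ τ ^ 2) / 2 := by
  obtain ⟨g, hg⟩ := serreDerivative_modular E₆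
  have ht : Tendsto g atImInfty (𝓝 (-1 / 2)) := by
    rw [hg]
    have h := ((isCuspHolo_modularForm E₆).tendsto_D).sub
      ((tendsto_E2.const_mul (((6 : ℕ) : ℤ) * 12⁻¹ : ℂ)).mul tendsto_E₆)
    convert! h using 2
    norm_num
  have hr : Module.rank ℂ (ModularForm 𝒮ℒ 8) = 1 := by
    have := dimension_level_one 8 (by decide)
    simpa [Nat.ModEq] using this
  have he : Tendsto (E₄.mul E₄) atImInfty (𝓝 1) := by
    have := tendsto_E₄.mul tendsto_E₄
    rw [one_mul] at this
    exact this
  have := exists_smul_eq_of_rank_one hr he g ht τ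
  rw [hg, serreDerivative_apply] at this
  have h2 : (E₄.mul E₄) τ = E₄ τ * E₄ τ := rfl
  rw [h2] at this
  push_cast at this
  linear_combination this

/-- The Dedekind eta function on the upper half-plane. -/
noncomputable def etaH (τ : ℍ) : ℂ := eta (τ : ℂ)

theorem etaH_ne_zero (τ : ℍ) : etaH τ ≠ 0 := eta_ne_zero τ.im_pos

theorem mdiff_etaH : MDiff etaH := by
  rw [UpperHalfPlane.mdifferentiable_iff]
  refine DifferentiableOn.congr (f := eta) (fun z hz =>
    (differentiableAt_eta_of_mem_upperHalfPlaneSet hz).differentiableWithinAt) fun z hz => ?_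
  simp [etaH, ofComplex_apply_of_im_pos hz]

theorem D_etaH (τ : ℍ) : D etaH τ = E2 τ * etaH τ / 24 := by
  have h := logDeriv_eta_eq_E2 τ
  have h2 : etaH ∘ ofComplex =ᶠ[𝓝 (τ : ℂ)] eta := by
    filter_upwards [isOpen_upperHalfPlaneSet.mem_nhds τ.im_pos] with z hz
    simp [ofComplex_apply_of_im_pos hz, etaH]
  rw [logDeriv_apply, div_eq_iff (eta_ne_zero τ.im_pos)] at h
  rw [normalizedDerivOfComplex, h2.deriv_eq, h]
  change _ * (_ * etaH τ) = _
  field_simp [Real.pi_ne_zero]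
  ring

theorem D_discriminant (τ : ℍ) : D discriminant τ = E2 τ * discriminant τ := by
  have h : discriminant = etaH ^ 24 := rfl
  rw [h, normalizedDerivOfComplex_pow _ _ mdiff_etaH]
  simp only [Pi.mul_apply, Pi.pow_apply, D_etaH]
  simp only [Nat.cast_ofNat, Pi.ofNat_apply]
  ring

theorem E₄_cube_sub_E₆_sq (τ : ℍ) : E₄ τ ^ 3 - E₆ τ ^ 2 = 1728 * discriminant τ := by
  rw [discriminant_eq_E₄_cube_sub_E₆_sq]; ring

/-! ### The zeros of `E₄` and `E₆` -/

/-- The ratio of consecutive seventh powers is at most `(3/2)^7 < 18`. The exponent 7 combines `n^6`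
from the coefficients with a factor `n` from `p^n - q^n`. -/
theorem add_two_pow_seven_le (m : ℕ) : ((m : ℝ) + 2) ^ 7 ≤ 128 * 18 ^ m := by
  induction m with
  | zero => norm_num
  | succ m ih =>
    have h : ((m : ℝ) + 3) ≤ 3 / 2 * ((m : ℝ) + 2) := by
      have : (0 : ℝ) ≤ m := m.cast_nonneg
      linarith
    calc ((↑(m + 1) : ℝ) + 2) ^ 7 = ((m : ℝ) + 3) ^ 7 := by push_cast; ring
      _ ≤ (3 / 2 * ((m : ℝ) + 2)) ^ 7 := by gcongr
      _ = (3 / 2) ^ 7 * ((m : ℝ) + 2) ^ 7 := by ring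
      _ ≤ 18 * (128 * 18 ^ m) := by gcongr; norm_num
      _ = 128 * 18 ^ (m + 1) := by ring

theorem norm_pow_sub_pow_le {p q : ℂ} {r : ℝ} (hp : ‖p‖ ≤ r) (hq : ‖q‖ ≤ r) (n : ℕ) :
    ‖p ^ (n + 1) - q ^ (n + 1)‖ ≤ ‖p - q‖ * ((n + 1) * r ^ n) := by
  have hr : 0 ≤ r := (norm_nonneg _).trans hp
  rw [← (Commute.all p q).mul_geom_sum₂, norm_mul]
  gcongr
  refine (norm_sum_le _ _).trans ((Finset.sum_le_card_nsmul _ _ (r ^ n) fun i hi => ?_).trans ?_)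
  · rw [norm_mul, norm_pow, norm_pow]
    have hi' : i + (n + 1 - 1 - i) = n := by have := Finset.mem_range.mp hi; omega
    calc ‖p‖ ^ i * ‖q‖ ^ (n + 1 - 1 - i) ≤ r ^ i * r ^ (n + 1 - 1 - i) := by gcongr
      _ = r ^ n := by rw [← pow_add, hi']
  · simp

/-- A power series with slowly growing coefficients is injective on a small disc. -/
theorem eq_of_hasSum_eq {a : ℕ → ℂ} {p q s : ℂ} (h1 : a 1 ≠ 0)
    (ha : ∀ n, ‖a n‖ ≤ ‖a 1‖ * n ^ 6 ∨ n = 0) (hp : ‖p‖ ≤ 1 / 200) (hq : ‖q‖ ≤ 1 / 200)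
    (hsp : HasSum (fun n => a n * p ^ n) s) (hsq : HasSum (fun n => a n * q ^ n) s) : p = q := by
  have h := hsp.sub hsq
  rw [sub_self, ← hasSum_nat_add_iff' 2] at h
  simp only [Finset.sum_range_succ, Finset.sum_range_zero] at h
  have hb : ∀ m : ℕ, ‖a (m + 2) * p ^ (m + 2) - a (m + 2) * q ^ (m + 2)‖ ≤
      ‖a 1‖ * ‖p - q‖ * (128 / 200) * (18 / 200) ^ m := by
    intro m
    rw [← mul_sub, norm_mul]
    have h2 := norm_pow_sub_pow_le hp hq (m + 1)
    have h3 : ‖a (m + 2)‖ ≤ ‖a 1‖ * (m + 2) ^ 6 := by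
      have := (ha (m + 2)).resolve_right (by omega)
      exact_mod_cast this
    calc ‖a (m + 2)‖ * ‖p ^ (m + 2) - q ^ (m + 2)‖
        ≤ (‖a 1‖ * (m + 2) ^ 6) * (‖p - q‖ * ((↑(m + 1) + 1) * (1 / 200) ^ (m + 1))) := by gcongr
      _ = ‖a 1‖ * ‖p - q‖ * (((m : ℝ) + 2) ^ 7) * (1 / 200) ^ (m + 1) := by push_cast; ring
      _ ≤ ‖a 1‖ * ‖p - q‖ * (128 * 18 ^ m) * (1 / 200) ^ (m + 1) := by
          gcongr; exact add_two_pow_seven_le m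
      _ = ‖a 1‖ * ‖p - q‖ * (128 / 200) * (18 / 200) ^ m := by
          rw [div_pow, div_pow, one_pow, pow_succ]; field_simp
  have hg := (hasSum_geometric_of_lt_one (r := (18 / 200 : ℝ)) (by norm_num)
    (by norm_num)).mul_left (‖a 1‖ * ‖p - q‖ * (128 / 200))
  have h4 := h.norm_le_of_bounded hg hb
  have h5 : ‖(0 : ℂ) - (0 + (a 0 * p ^ 0 - a 0 * q ^ 0) + (a 1 * p ^ 1 - a 1 * q ^ 1))‖
      = ‖a 1‖ * ‖p - q‖ := by
    rw [← norm_mul, ← norm_neg]; congr 1; ring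
  rw [h5] at h4
  -- The linear term is bounded by the tail, whose geometric bound is `0.64 / 0.91 < 1` times the
  -- linear term; this is absurd unless `p = q`.
  by_contra hne
  have : 0 < ‖a 1‖ * ‖p - q‖ := mul_pos (norm_pos_iff.mpr h1) (norm_pos_iff.mpr (sub_ne_zero.mpr hne))
  norm_num at h4
  nlinarith

/-- For `n > 0` the coefficients of `E_k` are `σ_{k-1}(n)` times the first one, and `σ_{k-1}(n) ≤
n^k ≤ n^6`. -/
theorem qq_eq_of_E_eq {k : ℕ} (hk : 3 ≤ k) (hk2 : Even k) (hk6 : k ≤ 6)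
    {σ τ : ℍ} (hσ : ‖qq σ‖ ≤ 1 / 200) (hτ : ‖qq τ‖ ≤ 1 / 200) (h : E hk σ = E hk τ) :
    qq σ = qq τ := by
  have hs : ∀ τ : ℍ, HasSum (fun n : ℕ => (qExpansion 1 (E hk)).coeff n * qq τ ^ n) (E hk τ) :=
    fun τ => by
      have : Fact (IsCusp OnePoint.infty 𝒮ℒ) :=
        ⟨(𝒮ℒ).isCusp_of_mem_strictPeriods one_pos one_mem_strictPeriods_SL⟩
      simpa using hasSum_qExpansion one_pos
        (SlashInvariantFormClass.periodic_comp_ofComplex (E hk) one_mem_strictPeriods_SL)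
        (ModularFormClass.holo (E hk)) (ModularFormClass.bdd_at_infty (E hk)) τ
  refine eq_of_hasSum_eq (s := E hk τ) ?_ ?_ hσ hτ (h ▸ hs σ) (hs τ)
  · have hk' : k = 4 ∨ k = 6 := by
      obtain ⟨j, rfl⟩ := hk2; omega
    rcases hk' with rfl | rfl
    · rw [E₄_qExpansion_coeff_one]; norm_num
    · rw [E₆_qExpansion_coeff_one]; norm_num
  · intro n
    rcases Nat.eq_zero_or_pos n with rfl | hn
    · right; rfl
    · left
      rw [E_qExpansion_coeff _ hk2, E_qExpansion_coeff _ hk2, if_neg hn.ne', if_neg one_ne_zero]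
      rw [ArithmeticFunction.isMultiplicative_sigma.map_one, norm_mul, Nat.cast_one, mul_one]
      gcongr
      rw [Complex.norm_natCast]
      have h1 := ArithmeticFunction.sigma_le_pow_succ (k - 1) n
      have h2 : n ^ (k - 1 + 1) ≤ n ^ 6 := Nat.pow_le_pow_right hn (by omega)
      exact_mod_cast h1.trans h2

/-- The hypothesis says `Im τ ≥ √3/2`, which holds on the standard fundamental domain, and `e^{-π√3}
≈ 0.0043`. -/
theorem norm_qq_le_of_im {τ : ℍ} (h : 3 ≤ 4 * τ.im ^ 2) : ‖qq τ‖ ≤ 1 / 200 := by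
  have him : (0.86 : ℝ) ≤ τ.im := by nlinarith [τ.im_pos]
  have hpi := Real.pi_gt_d2
  rw [qq, Function.Periodic.norm_qParam, one_div, div_one]
  have h1 : -2 * π * (τ : ℂ).im ≤ -5.4 := by
    change -2 * π * τ.im ≤ _
    nlinarith
  refine (Real.exp_le_exp.mpr h1).trans ?_
  rw [Real.exp_neg]
  refine inv_anti₀ (by norm_num) ?_
  have h5 : Real.exp 5.4 = Real.exp 1 ^ 5 * Real.exp 0.4 := by
    rw [← Real.exp_nat_mul, ← Real.exp_add]; norm_num
  have h6 : (1.4 : ℝ) ≤ Real.exp 0.4 := by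
    have := Real.add_one_le_exp (0.4 : ℝ); linarith
  have h7 : (2.71 : ℝ) ≤ Real.exp 1 := by have := Real.exp_one_gt_d9; linarith
  rw [h5]
  calc (200 : ℝ) ≤ 2.71 ^ 5 * 1.4 := by norm_num
    _ ≤ _ := by gcongr

theorem exists_zpow_T_smul_of_qq_eq {σ τ : ℍ} (h : qq σ = qq τ) :
    ∃ n : ℤ, σ = (ModularGroup.T ^ n) • τ := by
  rw [qq_eq_exp, qq_eq_exp, Complex.exp_eq_exp_iff_exists_int] at h
  obtain ⟨n, hn⟩ := h
  refine ⟨n, ?_⟩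
  rw [UpperHalfPlane.modular_T_zpow_smul]
  ext
  rw [UpperHalfPlane.coe_vadd]
  have := Complex.two_pi_I_ne_zero
  have h2 : (2 * π * I) * (σ : ℂ) = (2 * π * I) * (((n : ℝ) : ℂ) + τ) := by
    rw [hn]; push_cast; ring
  exact mul_left_cancel₀ this h2

theorem E_smul {k : ℕ} (hk : 3 ≤ k) (γ : SL(2, ℤ)) (τ : ℍ) :
    E hk (γ • τ) = denom γ τ ^ (k : ℤ) * E hk τ :=
  SlashInvariantForm.slash_action_eqn'' (Γ := 𝒮ℒ) (E hk) ⟨γ, rfl⟩ τ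

/-- A zero of `E_k` in the region `Im τ ≥ √3/2` determines all its zeros. -/
theorem mem_orbit_of_E_eq_zero {k : ℕ} (hk : 3 ≤ k) (hk2 : Even k) (hk6 : k ≤ 6)
    {σ τ : ℍ} (hσ : 3 ≤ 4 * σ.im ^ 2) (h0 : E hk σ = 0) (h : E hk τ = 0) :
    τ ∈ MulAction.orbit SL(2, ℤ) σ := by
  -- After moving `τ` into the fundamental domain, both zeros lie in the region where `q` is
  -- determined by the value of `E_k`, so they differ by a translation.
  obtain ⟨g, hg⟩ := ModularGroup.exists_smul_mem_fd τ
  have h1 : E hk (g • τ) = 0 := by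
    rw [E_smul, h, mul_zero]
  have h2 := qq_eq_of_E_eq hk hk2 hk6
    (norm_qq_le_of_im (ModularGroup.three_le_four_mul_im_sq_of_mem_fd hg))
    (norm_qq_le_of_im hσ) (h1.trans h0.symm)
  obtain ⟨n, hn⟩ := exists_zpow_T_smul_of_qq_eq h2
  refine ⟨g⁻¹ * ModularGroup.T ^ n, ?_⟩
  simp only
  rw [mul_smul, ← hn, inv_smul_smul]

theorem S_smul_I : ModularGroup.S • UpperHalfPlane.I = UpperHalfPlane.I := by
  rw [UpperHalfPlane.modular_S_smul]
  ext
  simp [UpperHalfPlane.I]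

/-- From `ρ² + ρ + 1 = 0` one gets `-1/ρ = ρ + 1`. So `S T⁻¹` fixes `T • ρ = e^{πi/3}` rather than
`ρ` itself. -/
theorem S_smul_ρ : ModularGroup.S • UpperHalfPlane.ρ = ModularGroup.T • UpperHalfPlane.ρ := by
  rw [UpperHalfPlane.modular_S_smul, UpperHalfPlane.modular_T_smul]
  ext
  rw [UpperHalfPlane.coe_vadd]
  refine inv_eq_of_mul_eq_one_right ?_
  push_cast
  linear_combination -UpperHalfPlane.ρ_sq

theorem S_mul_T_inv_smul : (ModularGroup.S * ModularGroup.T⁻¹) •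
    (ModularGroup.T • UpperHalfPlane.ρ) = ModularGroup.T • UpperHalfPlane.ρ := by
  rw [mul_smul, inv_smul_smul, S_smul_ρ]

theorem denom_T (τ : ℍ) : denom ModularGroup.T τ = 1 := by
  rw [ModularGroup.denom_apply]
  simp [ModularGroup.T]

theorem E₆_I : E₆ UpperHalfPlane.I = 0 := by
  have h := E_smul (by norm_num : 3 ≤ 6) ModularGroup.S UpperHalfPlane.I
  rw [S_smul_I, ModularGroup.denom_S] at h
  have h2 : (UpperHalfPlane.I : ℂ) ^ ((6 : ℕ) : ℤ) = -1 := by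
    rw [zpow_natCast]
    change Complex.I ^ 6 = -1
    rw [show 6 = 2 * 3 by rfl, pow_mul, Complex.I_sq]; norm_num
  rw [h2] at h
  linear_combination h / 2

theorem E₄_ρ : E₄ UpperHalfPlane.ρ = 0 := by
  have h := E_smul (by norm_num : 3 ≤ 4) ModularGroup.S UpperHalfPlane.ρ
  rw [S_smul_ρ, E_smul, ModularGroup.denom_S, denom_T, one_zpow, one_mul, zpow_natCast] at h
  have h2 : (UpperHalfPlane.ρ : ℂ) ^ 4 = UpperHalfPlane.ρ := by
    linear_combination ((UpperHalfPlane.ρ : ℂ) ^ 2 - UpperHalfPlane.ρ) * UpperHalfPlane.ρ_sq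
  rw [h2] at h
  have h3 : (UpperHalfPlane.ρ : ℂ) - 1 ≠ 0 := by
    intro h0
    have := congrArg Complex.im h0
    have hp := UpperHalfPlane.ρ.im_pos
    simp at this
    exact hp.ne' this
  have h4 : ((UpperHalfPlane.ρ : ℂ) - 1) * E₄ UpperHalfPlane.ρ = 0 := by linear_combination -h
  exact (mul_eq_zero.mp h4).resolve_left h3

theorem E_eq_zero_of_mem_orbit {k : ℕ} (hk : 3 ≤ k) {σ τ : ℍ} (h : E hk σ = 0)
    (hτ : τ ∈ MulAction.orbit SL(2, ℤ) σ) : E hk τ = 0 := by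
  obtain ⟨γ, rfl⟩ := hτ
  simp only
  rw [E_smul, h, mul_zero]

theorem E₆_eq_zero_iff {τ : ℍ} : E₆ τ = 0 ↔ τ ∈ ellipticPointsI := by
  refine ⟨fun h => mem_orbit_of_E_eq_zero _ (by decide) le_rfl ?_ E₆_I h,
    fun h => E_eq_zero_of_mem_orbit _ E₆_I h⟩
  change 3 ≤ 4 * Complex.I.im ^ 2
  norm_num

theorem E₄_eq_zero_iff {τ : ℍ} : E₄ τ = 0 ↔ τ ∈ ellipticPointsRho := by
  refine ⟨fun h => mem_orbit_of_E_eq_zero _ (by decide) (by norm_num) ?_ E₄_ρ h,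
    fun h => E_eq_zero_of_mem_orbit _ E₄_ρ h⟩
  change 3 ≤ 4 * (Real.sqrt 3 / 2) ^ 2
  rw [div_pow, Real.sq_sqrt (by norm_num)]
  norm_num

/-! ### Vector-valued forms and the expansion of `Ξ` at the cusp -/

/-- `q^s = e^{2πisτ}`. -/
noncomputable def qPow (s : ℂ) (τ : ℍ) : ℂ := exp (2 * π * I * s * τ)

theorem qPow_add (s t : ℂ) (τ : ℍ) : qPow (s + t) τ = qPow s τ * qPow t τ := by
  rw [qPow, qPow, qPow, ← Complex.exp_add]; ring_nf

theorem qPow_ne_zero (s : ℂ) (τ : ℍ) : qPow s τ ≠ 0 := Complex.exp_ne_zero _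

theorem qPow_one (τ : ℍ) : qPow 1 τ = qq τ := by rw [qPow, qq_eq_exp, mul_one]

theorem qPow_intCast (n : ℤ) (τ : ℍ) : qPow n τ = qq τ ^ n := by
  rw [qq_eq_exp, ← Complex.exp_int_mul, qPow]; ring_nf

theorem qPow_zero (τ : ℍ) : qPow 0 τ = 1 := by simp [qPow]

theorem qPow_neg_mul (s : ℂ) (τ : ℍ) : qPow (-s) τ * qPow s τ = 1 := by
  rw [← qPow_add, neg_add_cancel, qPow_zero]

theorem qPow_comp_ofComplex (s : ℂ) (τ : ℍ) :
    qPow s ∘ ofComplex =ᶠ[𝓝 (τ : ℂ)] fun z => exp (2 * π * I * s * z) := by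
  filter_upwards [isOpen_upperHalfPlaneSet.mem_nhds τ.im_pos] with z hz
  simp [ofComplex_apply_of_im_pos hz, qPow]

theorem mdiff_qPow (s : ℂ) : MDiff (qPow s) := fun τ => by
  rw [UpperHalfPlane.mdifferentiableAt_iff]
  exact DifferentiableAt.congr_of_eventuallyEq (by fun_prop) (qPow_comp_ofComplex s τ)

theorem D_qPow (s : ℂ) (τ : ℍ) : D (qPow s) τ = s * qPow s τ := by
  have h : HasDerivAt (fun z : ℂ => exp (2 * π * I * s * z))
      (exp (2 * π * I * s * τ) * (2 * π * I * s * 1)) τ :=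
    ((hasDerivAt_id (τ : ℂ)).const_mul _).cexp
  rw [normalizedDerivOfComplex, (qPow_comp_ofComplex s τ).deriv_eq, h.deriv, qPow]
  field_simp [Real.pi_ne_zero]

theorem qPow_vadd_one (s : ℂ) (τ : ℍ) :
    qPow s ((1 : ℝ) +ᵥ τ) = exp (2 * π * I * s) * qPow s τ := by
  rw [qPow, qPow, ← Complex.exp_add, UpperHalfPlane.coe_vadd]
  push_cast
  ring_nf

variable {d : ℕ} {ρ : SL(2, ℤ) →* GL (Fin d) ℂ} {Λ : Fin d → ℚ}

/-- Holomorphic vector-valued functions on the upper half-plane that transform with weight `k`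
according to `ρ`. -/
structure IsVVForm (ρ : SL(2, ℤ) →* GL (Fin d) ℂ) (k : ℤ) (f : ℍ → Fin d → ℂ) : Prop where
  mdiff : ∀ ξ, MDiff fun τ => f τ ξ
  smul : ∀ (γ : SL(2, ℤ)) (τ : ℍ), f (γ • τ) =
    denom γ τ ^ k • ((ρ γ : Matrix (Fin d) (Fin d) ℂ) *ᵥ f τ)

theorem IsVVForm.periodic (hΛ : IsExponentMatrix ρ Λ) {Y : ℍ → Fin d → ℂ}
    (hY : IsVVForm ρ 0 Y) (ξ : Fin d) (m : ℤ) :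
    Function.Periodic ((fun τ => qPow (m - Λ ξ) τ * Y τ ξ) ∘ ofComplex) 1 := by
  apply periodic_comp_ofComplex_of_vadd
  intro τ
  have h1 : Y ((1 : ℝ) +ᵥ τ) ξ = exp (2 * π * I * Λ ξ) * Y τ ξ := by
    rw [← UpperHalfPlane.modular_T_smul, hY.smul, hΛ, zpow_zero, one_smul,
      Matrix.mulVec_diagonal]
  rw [h1, qPow_vadd_one]
  have h2 : exp (2 * π * I * (m - Λ ξ)) * exp (2 * π * I * Λ ξ) = 1 := by
    rw [← Complex.exp_add]
    have := Complex.exp_int_mul_two_pi_mul_I m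
    rw [← this]; ring_nf
  linear_combination (qPow (m - Λ ξ) τ * Y τ ξ) * h2

theorem HasQExpansion.iff_qPow {X : ℍ → Fin d → ℂ} {c : ℤ → Fin d → ℂ} :
    HasQExpansion Λ X c ↔
      ∀ τ ξ, HasSum (fun n : ℤ => c n ξ * qq τ ^ n) (qPow (-Λ ξ) τ * X τ ξ) := by
  have h : ∀ (τ : ℍ) (n : ℤ), exp (2 * π * I * (n : ℂ) * (τ : ℂ)) = qq τ ^ n := fun τ n =>
    qPow_intCast n τ
  have h' : ∀ (τ : ℍ) (ξ : Fin d), exp (-(2 * π * I * (Λ ξ : ℂ) * (τ : ℂ))) = qPow (-Λ ξ) τ :=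
    fun τ ξ => by rw [qPow]; ring_nf
  simp only [HasQExpansion, h, h']

/-- Boundedness makes `q^{-Λ} Y` a power series in `q`, so its principal part is zero, and the
principal part map is injective. Only this consequence of bijectivity is used to prove that forms
vanish. -/
theorem eq_zero_of_bounded (hΛ : IsExponentMatrix ρ Λ) (hP : PrincipalPartInvertible ρ Λ)
    {Y : ℍ → Fin d → ℂ} (hY : IsVVForm ρ 0 Y)
    (hb : ∀ ξ, IsBoundedAtImInfty fun τ => qPow (-Λ ξ) τ * Y τ ξ) : Y = 0 := by
  have hs : ∀ τ ξ, HasSum (fun n : ℕ => (qExpansion 1 fun τ => qPow (-Λ ξ) τ * Y τ ξ).coeff n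
      * qq τ ^ n) (qPow (-Λ ξ) τ * Y τ ξ) := fun τ ξ => by
    have hper := hY.periodic hΛ ξ 0
    simp only [Int.cast_zero, zero_sub] at hper
    exact hasSum_qExpansion one_pos (by simpa using hper)
      ((mdiff_qPow _).mul (hY.mdiff ξ)) (hb ξ) τ
  let c : ℤ → Fin d → ℂ := fun n ξ => if 0 ≤ n then
    (qExpansion 1 fun τ => qPow (-Λ ξ) τ * Y τ ξ).coeff n.toNat else 0
  have hc : HasQExpansion Λ Y c := by
    rw [HasQExpansion.iff_qPow]
    intro τ ξ
    rw [← (Nat.cast_injective (R := ℤ)).hasSum_iff]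
    · simpa [Function.comp_def, c] using hs τ ξ
    · intro n hn
      have : ¬ 0 ≤ n := fun h => hn ⟨n.toNat, by simp [h]⟩
      simp [c, this]
  have hcneg : ∀ n < 0, c n = 0 := fun n hn => by
    funext ξ; simp [c, not_le.mpr hn]
  have h0 : HasQExpansion Λ (0 : ℍ → Fin d → ℂ) 0 := fun τ ξ => by
    simp
  have hM : ∀ {X : ℍ → Fin d → ℂ} {c : ℤ → Fin d → ℂ}, IsVVForm ρ 0 X → HasQExpansion Λ X c →
      (∀ n < 0, c n = 0) → X ∈ vvModularFunctions ρ := fun {X c} hX hc hn =>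
    ⟨hX.mdiff, fun γ τ => by rw [hX.smul, zpow_zero, one_smul],
      Λ, hΛ, c, hc, by
        convert Set.finite_empty
        ext n
        simp only [Set.mem_ofPred_eq, Set.mem_empty_iff_false, iff_false, not_and, not_not]
        exact hn n⟩
  have hpp : ∀ {X : ℍ → Fin d → ℂ} {c : ℤ → Fin d → ℂ}, HasQExpansion Λ X c →
      (∀ n < 0, c n = 0) → principalPart Λ X = 0 := fun {X c} hc hn => by
    funext n
    rw [principalPart, hc.qCoeff_eq]
    split_ifs with h
    · exact hn n h
    · rfl
  have h0V : IsVVForm ρ 0 (0 : ℍ → Fin d → ℂ) :=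
    ⟨fun ξ => mdifferentiable_const, fun γ τ => by simp⟩
  exact hP.injOn (hM hY hc hcneg) (hM h0V h0 fun _ _ => rfl)
    ((hpp hc hcneg).trans (hpp h0 fun _ _ => rfl).symm)

theorem isVVForm_of_mem {X : ℍ → Fin d → ℂ} (hX : X ∈ vvModularFunctions ρ) :
    IsVVForm ρ 0 X :=
  ⟨hX.1, fun γ τ => by rw [hX.2.1, zpow_zero, one_smul]⟩

/-- Membership in `M(ρ)` only provides an expansion for some exponent matrix. Two exponent matrices
differ by integers, so passing to `Λ` shifts the indices in each component. -/
theorem hasQExpansion_qCoeff (hΛ : IsExponentMatrix ρ Λ) {X : ℍ → Fin d → ℂ}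
    (hX : X ∈ vvModularFunctions ρ) : HasQExpansion Λ X (qCoeff Λ X) := by
  obtain ⟨-, -, Λ', hΛ', c, hc, -⟩ := hX
  have hm : ∀ ξ, ∃ m : ℤ, (Λ' ξ : ℂ) = Λ ξ + m := by
    intro ξ
    have h : exp (2 * π * I * (Λ' ξ : ℂ)) = exp (2 * π * I * (Λ ξ : ℂ)) := by
      have := hΛ'.symm.trans hΛ
      exact congrFun (Matrix.diagonal_injective this) ξ
    obtain ⟨n, hn⟩ := Complex.exp_eq_exp_iff_exists_int.mp h
    refine ⟨n, mul_left_cancel₀ Complex.two_pi_I_ne_zero ?_⟩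
    rw [hn]; ring
  choose m hm using hm
  have : HasQExpansion Λ X fun n ξ => c (n - m ξ) ξ := by
    rw [HasQExpansion.iff_qPow] at hc ⊢
    intro τ ξ
    have h := (hc τ ξ).mul_left (qq τ ^ m ξ)
    rw [← (Equiv.addRight (m ξ)).hasSum_iff]
    convert! h using 1
    · funext n
      simp only [Function.comp_apply, Equiv.coe_addRight, add_sub_cancel_right]
      rw [zpow_add₀ (qq_ne_zero τ)]; ring
    · rw [← qPow_intCast, ← mul_assoc, ← qPow_add, hm ξ]
      congr 2; ring
  rw [this.qCoeff_eq]
  exact this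

theorem canonicalBasisVector_spec (hP : PrincipalPartInvertible ρ Λ) (j : Fin d) :
    canonicalBasisVector ρ Λ j 1 ∈ vvModularFunctions ρ ∧
      principalPart Λ (canonicalBasisVector ρ Λ j 1) =
        fun m ξ => if m = -1 ∧ ξ = j then 1 else 0 := by
  have hp : (fun m ξ => if m = -(1 : ℤ) ∧ ξ = j then (1 : ℂ) else 0) ∈ principalParts d := by
    refine ⟨(Set.finite_singleton (-1 : ℤ)).subset fun n hn => ?_, fun n hn => ?_⟩
    · by_contra h
      refine hn (funext fun ξ => if_neg fun h' => h h'.1)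
    · funext ξ
      exact if_neg (by omega)
  exact Function.invFunOn_pos (hP.surjOn hp)

theorem isVVForm_canonicalBasisVector (hP : PrincipalPartInvertible ρ Λ) (j : Fin d) :
    IsVVForm ρ 0 (canonicalBasisVector ρ Λ j 1) :=
  isVVForm_of_mem (canonicalBasisVector_spec hP j).1

/-- The expansion of `q^{1-Λ} Ξ` at the cusp. -/
theorem exists_isCuspHolo_fundamentalMatrix (hΛ : IsExponentMatrix ρ Λ)
    (hP : PrincipalPartInvertible ρ Λ) (ξ j : Fin d) :
    ∃ G : ℂ → ℂ, IsCuspHolo (fun τ => qPow (1 - Λ ξ) τ * fundamentalMatrix ρ Λ τ ξ j) G ∧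
      G 0 = (1 : Matrix (Fin d) (Fin d) ℂ) ξ j ∧ deriv G 0 = characteristicMatrix ρ Λ ξ j := by
  obtain ⟨hM, hpp⟩ := canonicalBasisVector_spec hP j
  set X := canonicalBasisVector ρ Λ j 1 with hXdef
  have hX := isVVForm_of_mem hM
  have hc := HasQExpansion.iff_qPow.mp (hasQExpansion_qCoeff hΛ hM)
  have hneg : ∀ n < 0, qCoeff Λ X n ξ = if n = -1 ∧ ξ = j then 1 else 0 := fun n hn => by
    rw [← congrFun (congrFun hpp n) ξ, principalPart, if_pos hn]
  have hs : ∀ τ : ℍ, HasSum (fun m : ℕ => qCoeff Λ X (m - 1) ξ •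
      Function.Periodic.qParam (1 : ℝ) τ ^ m) (qPow (1 - Λ ξ) τ * X τ ξ) := by
    intro τ
    have h := (hc τ ξ).mul_left (qq τ)
    have hinj : Function.Injective fun m : ℕ => (m : ℤ) - 1 := fun a b h => by
      simpa using h
    rw [← hinj.hasSum_iff] at h
    · convert! h using 1
      · funext m
        simp only [Function.comp_apply, smul_eq_mul]
        rw [zpow_sub₀ (qq_ne_zero τ), zpow_natCast, zpow_one]
        field_simp [qq_ne_zero τ]
      · rw [← qPow_one, ← mul_assoc, ← qPow_add]; rfl
    · intro n hn
      have hn' : n < -1 := by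
        by_contra h'
        exact hn ⟨(n + 1).toNat, by simp only; omega⟩
      rw [hneg n (by omega), if_neg (by omega)]; simp
  have hper := hX.periodic hΛ ξ 1
  simp only [Int.cast_one] at hper
  obtain ⟨h1, h2, h3⟩ := isCuspHolo_of_hasSum hper ((mdiff_qPow _).mul (hX.mdiff ξ)) hs
  refine ⟨_, h1, ?_, ?_⟩
  · refine h2.trans ?_
    rw [hneg _ (by norm_num), Matrix.one_apply]
    simp
  · refine h3.trans ?_
    simp [characteristicMatrix, hXdef]

/-! ### Operations on scalar and vector-valued forms -/

/-- Holomorphic functions on the upper half-plane that transform with weight `k`. -/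
structure IsScalarForm (k : ℤ) (g : ℍ → ℂ) : Prop where
  mdiff : MDiff g
  smul : ∀ (γ : SL(2, ℤ)) (τ : ℍ), g (γ • τ) = denom γ τ ^ k * g τ

theorem denom_zpow_ne_zero (γ : SL(2, ℤ)) (τ : ℍ) (k : ℤ) : denom γ τ ^ k ≠ 0 :=
  zpow_ne_zero _ (denom_ne_zero _ _)

theorem isScalarForm_E {k : ℕ} (hk : 3 ≤ k) : IsScalarForm k (E hk) :=
  ⟨ModularFormClass.holo _, E_smul hk⟩

theorem isScalarForm_E₄ : IsScalarForm 4 E₄ := isScalarForm_E _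
theorem isScalarForm_E₆ : IsScalarForm 6 E₆ := isScalarForm_E _

theorem isScalarForm_discriminant : IsScalarForm 12 discriminant :=
  ⟨mdiff_discriminant, fun γ τ =>
    SlashInvariantForm.slash_action_eqn'' (Γ := 𝒮ℒ) CuspForm.discriminant ⟨γ, rfl⟩ τ⟩

theorem mdiff_inv {g : ℍ → ℂ} (hg : MDiff g) (h0 : ∀ τ, g τ ≠ 0) : MDiff fun τ => (g τ)⁻¹ := by
  rw [UpperHalfPlane.mdifferentiable_iff] at hg ⊢
  exact hg.inv fun z _ => h0 _

namespace IsScalarForm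

variable {k l : ℤ} {f g : ℍ → ℂ}

theorem mul (hf : IsScalarForm k f) (hg : IsScalarForm l g) :
    IsScalarForm (k + l) fun τ => f τ * g τ :=
  ⟨hf.mdiff.mul hg.mdiff, fun γ τ => by
    rw [hf.smul, hg.smul, zpow_add₀ (denom_ne_zero _ _)]; ring⟩

theorem inv (hf : IsScalarForm k f) (h0 : ∀ τ, f τ ≠ 0) : IsScalarForm (-k) fun τ => (f τ)⁻¹ :=
  ⟨mdiff_inv hf.mdiff h0, fun γ τ => by rw [hf.smul, mul_inv, zpow_neg]⟩

end IsScalarForm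

namespace IsVVForm

variable {k l : ℤ} {f g : ℍ → Fin d → ℂ}

theorem scalar_mul {c : ℍ → ℂ} (hc : IsScalarForm k c) (hf : IsVVForm ρ l f) :
    IsVVForm ρ (k + l) fun τ => c τ • f τ :=
  ⟨fun ξ => hc.mdiff.mul (hf.mdiff ξ), fun γ τ => by
    rw [hc.smul, hf.smul, zpow_add₀ (denom_ne_zero _ _), Matrix.mulVec_smul, smul_smul, smul_smul]
    ring_nf⟩

theorem const_smul (c : ℂ) (hf : IsVVForm ρ k f) : IsVVForm ρ k fun τ => c • f τ :=
  ⟨fun ξ => mdifferentiable_const.mul (hf.mdiff ξ), fun γ τ => by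
    rw [hf.smul, Matrix.mulVec_smul, smul_comm]⟩

theorem sub (hf : IsVVForm ρ k f) (hg : IsVVForm ρ k g) : IsVVForm ρ k fun τ => f τ - g τ :=
  ⟨fun ξ => (hf.mdiff ξ).sub (hg.mdiff ξ), fun γ τ => by
    rw [hf.smul, hg.smul, Matrix.mulVec_sub, smul_sub]⟩

theorem add (hf : IsVVForm ρ k f) (hg : IsVVForm ρ k g) : IsVVForm ρ k fun τ => f τ + g τ :=
  ⟨fun ξ => (hf.mdiff ξ).add (hg.mdiff ξ), fun γ τ => by
    rw [hf.smul, hg.smul, Matrix.mulVec_add, smul_add]⟩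

theorem sum {ι : Type*} (s : Finset ι) {f : ι → ℍ → Fin d → ℂ} (hf : ∀ i, IsVVForm ρ k (f i)) :
    IsVVForm ρ k fun τ => ∑ i ∈ s, f i τ := by
  classical
  induction s using Finset.induction_on with
  | empty => exact ⟨fun ξ => by simpa using mdifferentiable_const, fun γ τ => by simp⟩
  | insert a s ha ih => simpa [Finset.sum_insert ha] using (hf a).add ih

/-- In weight 0 the anomalous term of `D` under the slash action disappears, and the entries of
`ρ(γ)` are constants. -/
theorem normalizedDeriv (hf : IsVVForm ρ 0 f) :
    IsVVForm ρ 2 fun τ ξ => D (fun σ => f σ ξ) τ := by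
  refine ⟨fun ξ => normalizedDerivOfComplex_mdifferentiable (hf.mdiff ξ), fun γ τ => ?_⟩
  funext ξ
  have h1 : (fun σ => f σ ξ) ∣[(0 : ℤ)] γ =
      ∑ ζ, (ρ γ : Matrix (Fin d) (Fin d) ℂ) ξ ζ • fun σ => f σ ζ := by
    funext σ
    rw [SL_slash_apply, hf.smul]
    simp [Matrix.mulVec, dotProduct]
  have h2 := congrFun (normalizedDerivOfComplex_SL_slash (k := 0) (hf.mdiff ξ) (γ := γ)) τ
  have h3 : ∀ s : Finset (Fin d), MDiff (∑ ζ ∈ s, (ρ γ : Matrix (Fin d) (Fin d) ℂ) ξ ζ •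
      fun σ => f σ ζ) ∧ D (∑ ζ ∈ s, (ρ γ : Matrix (Fin d) (Fin d) ℂ) ξ ζ • fun σ => f σ ζ) =
        ∑ ζ ∈ s, (ρ γ : Matrix (Fin d) (Fin d) ℂ) ξ ζ • D fun σ => f σ ζ := by
    intro s
    induction s using Finset.induction_on with
    | empty =>
      exact ⟨mdifferentiable_const (c := (0 : ℂ)), normalizedDerivOfComplex_const 0⟩
    | insert a s ha ih =>
      have hm : MDiff ((ρ γ : Matrix (Fin d) (Fin d) ℂ) ξ a • fun σ => f σ a) :=
        mdifferentiable_const.mul (hf.mdiff a)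
      rw [Finset.sum_insert ha, Finset.sum_insert ha]
      exact ⟨hm.add ih.1, by
        rw [normalizedDerivOfComplex_add _ _ hm ih.1, ih.2,
          normalizedDerivOfComplex_smul _ _ (hf.mdiff a)]⟩
  rw [h1, (h3 _).2] at h2
  simp only [Finset.sum_apply, Pi.smul_apply, smul_eq_mul, zero_add, Pi.sub_apply,
    SL_slash_apply, Int.cast_zero, zero_mul, sub_zero] at h2
  simp only [Pi.smul_apply, smul_eq_mul, Matrix.mulVec, dotProduct]
  rw [h2, zpow_neg, mul_comm, mul_assoc, inv_mul_cancel₀ (denom_zpow_ne_zero γ τ 2), mul_one]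

end IsVVForm

/-! ### The differential equation of the fundamental matrix -/

theorem isBigO_sq_of_analyticAt {h : ℂ → ℂ} (ha : AnalyticAt ℂ h 0) (h0 : h 0 = 0)
    (h1 : deriv h 0 = 0) : h =O[𝓝 0] fun z => z ^ 2 := by
  obtain ⟨p, hp⟩ := ha
  have hd : AnalyticAt ℂ (dslope h 0) 0 := ⟨_, hp.has_fpower_series_dslope_fslope⟩
  have h2 := hd.differentiableAt.isBigO_sub
  simp only [dslope_same, h1, sub_zero] at h2
  have h3 : ∀ z, h z = z * dslope h 0 z := fun z => by
    have := sub_smul_dslope h 0 z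
    simpa [h0] using this.symm
  have h4 := (Asymptotics.isBigO_refl (fun z : ℂ => z) (𝓝 0)).mul h2
  simpa [← h3, ← sq] using h4

theorem norm_qq (τ : ℍ) : ‖qq τ‖ = Real.exp (-2 * π * τ.im) := by
  rw [qq, Function.Periodic.norm_qParam, div_one]
  rfl

theorem qq_isBigO_discriminant : qq =O[atImInfty] discriminant := by
  refine (Asymptotics.IsBigO.of_bound 1 (.of_forall fun τ => ?_)).trans exp_isBigO_discriminant
  rw [one_mul, norm_qq, Real.norm_of_nonneg (Real.exp_pos _).le]

theorem discriminant_isBigO_qq : discriminant =O[atImInfty] qq := by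
  refine (CuspFormClass.exp_decay_atImInfty (h := 1) CuspForm.discriminant one_pos
    one_mem_strictPeriods_SL).trans (Asymptotics.IsBigO.of_bound 1 (.of_forall fun τ => ?_))
  rw [one_mul, norm_qq, Real.norm_of_nonneg (Real.exp_pos _).le]
  simp

theorem isCuspHolo_discriminant : IsCuspHolo discriminant (cuspFunction 1 discriminant) :=
  ⟨fun _ hz => (ModularFormClass.differentiableAt_cuspFunction CuspForm.discriminant one_pos
      one_mem_strictPeriods_SL (by simpa using hz)).differentiableWithinAt,
    fun τ => (SlashInvariantFormClass.eq_cuspFunction CuspForm.discriminant τ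
      one_mem_strictPeriods_SL one_ne_zero).symm⟩

theorem cuspFunction_discriminant_zero : cuspFunction 1 discriminant 0 = 0 :=
  CuspFormClass.cuspFunction_apply_zero CuspForm.discriminant one_pos one_mem_strictPeriods_SL

theorem deriv_cuspFunction_discriminant : deriv (cuspFunction 1 discriminant) 0 = 1 := by
  rw [cuspFunction_coeff_one, discriminant_qExpansion_coeff_one]

theorem mdiff_fundamentalMatrix (hP : PrincipalPartInvertible ρ Λ) (ξ j : Fin d) :
    MDiff fun τ => fundamentalMatrix ρ Λ τ ξ j :=
  (isVVForm_canonicalBasisVector hP j).mdiff ξ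

/-- The fundamental matrix satisfies a first order differential equation. -/
theorem fundamentalMatrix_ode (hΛ : IsExponentMatrix ρ Λ)
    (hP : PrincipalPartInvertible ρ Λ) (ξ j : Fin d) (τ : ℍ) :
    E₄ τ * E₆ τ * D (fun σ => fundamentalMatrix ρ Λ σ ξ j) τ =
      (Λ j - 1) * fundamentalMatrix ρ Λ τ ξ j * (E₄ τ ^ 3 - 984 * discriminant τ) +
        discriminant τ * (fundamentalMatrix ρ Λ τ * shiftedCharacteristicMatrix ρ Λ) ξ j := by
  set C := shiftedCharacteristicMatrix ρ Λ with hC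
  let X : Fin d → ℍ → Fin d → ℂ := fun ζ => canonicalBasisVector ρ Λ ζ 1
  have hX : ∀ ζ, IsVVForm ρ 0 (X ζ) := isVVForm_canonicalBasisVector hP
  have hΔi := isScalarForm_discriminant.inv discriminant_ne_zero
  -- `Y` is the defect of the equation divided by `Δ`, which makes it a form of weight 0; the aim is
  -- to show `Y = 0`.
  let Y : ℍ → Fin d → ℂ := fun τ =>
    (E₄ τ * E₆ τ * (discriminant τ)⁻¹) • (fun ξ => D (fun σ => X j σ ξ) τ) -
    ((Λ j - 1 : ℂ) • (((E₄ τ * (E₄ τ * E₄ τ)) * (discriminant τ)⁻¹) • X j τ - (984 : ℂ) • X j τ)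
      + ∑ ζ, C ζ j • X ζ τ)
  have hY : IsVVForm ρ 0 Y := by
    have h1 := ((isScalarForm_E₄.mul isScalarForm_E₆).mul hΔi)
    have h2 := ((isScalarForm_E₄.mul (isScalarForm_E₄.mul isScalarForm_E₄)).mul hΔi)
    exact (IsVVForm.scalar_mul h1 (hX j).normalizedDeriv).sub
      (((((hX j).scalar_mul h2).sub ((hX j).const_smul 984)).const_smul _).add
        (IsVVForm.sum _ fun ζ => (hX ζ).const_smul _))
  have hYeq : ∀ τ ξ, discriminant τ * Y τ ξ = E₄ τ * E₆ τ * D (fun σ => X j σ ξ) τ -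
      ((Λ j - 1) * X j τ ξ * (E₄ τ ^ 3 - 984 * discriminant τ) +
        discriminant τ * ∑ ζ, X ζ τ ξ * C ζ j) := by
    intro τ ξ
    have h0 := discriminant_ne_zero τ
    simp only [Y, Pi.sub_apply, Pi.add_apply, Pi.smul_apply, smul_eq_mul, Finset.sum_apply]
    rw [Finset.sum_congr rfl fun ζ _ => mul_comm (C ζ j) (X ζ τ ξ)]
    field_simp
  have hb : ∀ ξ, IsBoundedAtImInfty fun τ => qPow (-Λ ξ) τ * Y τ ξ := by
    intro ξ
    choose G hG hG0 hG1 using fun ζ => exists_isCuspHolo_fundamentalMatrix hΛ hP ξ ζ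
    have h4 := isCuspHolo_modularForm E₄
    have h6 := isCuspHolo_modularForm E₆
    have hδ := isCuspHolo_discriminant
    set e4 := cuspFunction 1 E₄ with he4
    set e6 := cuspFunction 1 E₆ with he6
    set δ := cuspFunction 1 discriminant with hδdef
    -- As a function of `q`, `h` is `qΔ · q^{-Λ} Y`. Since `Δ` is of order `q`, boundedness of
    -- `q^{-Λ} Y` follows once `h` vanishes to second order at `q = 0`.
    let h : ℂ → ℂ := fun z => e4 z * e6 z * (z * deriv (G j) z + (Λ ξ - 1) * G j z) -
      ((Λ j - 1) * G j z * (e4 z ^ 3 - 984 * δ z) + δ z * ∑ ζ, G ζ z * C ζ j)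
    have hh : ∀ τ, h (qq τ) = qq τ * discriminant τ * (qPow (-Λ ξ) τ * Y τ ξ) := by
      intro τ
      have hD := (hG j).D_eq τ
      have hD2 := congrFun (normalizedDerivOfComplex_mul (qPow (1 - Λ ξ)) (fun σ => X j σ ξ)
        (mdiff_qPow _) ((hX j).mdiff ξ)) τ
      simp only [Pi.add_apply, Pi.mul_apply, D_qPow] at hD2
      have hGq : ∀ ζ, G ζ (qq τ) = qPow (1 - Λ ξ) τ * X ζ τ ξ := fun ζ => ((hG ζ).eq τ).symm
      have hD3 : qq τ * deriv (G j) (qq τ) + (Λ ξ - 1) * G j (qq τ) =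
          qPow (1 - Λ ξ) τ * D (fun σ => X j σ ξ) τ := by
        rw [← hD, hGq]
        refine (congrArg (· + _) hD2).trans ?_
        ring
      have hq : qq τ * discriminant τ * (qPow (-Λ ξ) τ * Y τ ξ) =
          qPow (1 - Λ ξ) τ * (discriminant τ * Y τ ξ) := by
        rw [sub_eq_add_neg, qPow_add, qPow_one]; ring
      simp only [h]
      rw [hD3, hq, hYeq, ← h4.eq, ← h6.eq, ← hδ.eq]
      simp only [hGq]
      have hsum : ∑ ζ, qPow (1 - Λ ξ) τ * X ζ τ ξ * C ζ j =
          qPow (1 - Λ ξ) τ * ∑ ζ, X ζ τ ξ * C ζ j := by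
        rw [Finset.mul_sum]; exact Finset.sum_congr rfl fun ζ _ => by ring
      rw [hsum]
      ring
    have hS : AnalyticAt ℂ (fun z => ∑ ζ, G ζ z * C ζ j) 0 :=
      Finset.analyticAt_fun_sum _ fun ζ _ => ((hG ζ).analyticAt).mul analyticAt_const
    have hS0 : ∑ ζ, G ζ 0 * C ζ j = C ξ j := by
      simp [hG0, Matrix.one_apply]
    have hg := (hG j).analyticAt
    have ha : AnalyticAt ℂ h 0 := by
      have := hg.deriv
      have := h4.analyticAt
      have := h6.analyticAt
      have := hδ.analyticAt
      fun_prop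
    have v4 : e4 0 = 1 := by
      rw [he4, cuspFunction_coeff_zero, E_qExpansion_coeff_zero _ ⟨2, rfl⟩]
    have v6 : e6 0 = 1 := by
      rw [he6, cuspFunction_coeff_zero, E_qExpansion_coeff_zero _ ⟨3, rfl⟩]
    have vδ : δ 0 = 0 := cuspFunction_discriminant_zero
    have d4 : HasDerivAt e4 240 0 := by
      have := h4.analyticAt.differentiableAt.hasDerivAt
      rwa [he4, cuspFunction_coeff_one, E₄_qExpansion_coeff_one] at this
    have d6 : HasDerivAt e6 (-504) 0 := by
      have := h6.analyticAt.differentiableAt.hasDerivAt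
      rwa [he6, cuspFunction_coeff_one, E₆_qExpansion_coeff_one] at this
    have dδ : HasDerivAt δ 1 0 := by
      have := hδ.analyticAt.differentiableAt.hasDerivAt
      rwa [hδdef, deriv_cuspFunction_discriminant] at this
    have dG : HasDerivAt (G j) (characteristicMatrix ρ Λ ξ j) 0 := by
      rw [← hG1 j]; exact hg.differentiableAt.hasDerivAt
    have dG' := hg.deriv.differentiableAt.hasDerivAt
    have dS := hS.differentiableAt.hasDerivAt
    have hCξ : C ξ j = characteristicMatrix ρ Λ ξ j + (Λ ξ * characteristicMatrix ρ Λ ξ j -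
        characteristicMatrix ρ Λ ξ j * Λ j) := by
      simp [hC, shiftedCharacteristicMatrix, exponentMatrix, Matrix.diagonal_mul,
        Matrix.mul_diagonal]
    have hone : ((Λ ξ : ℂ) - Λ j) * (1 : Matrix (Fin d) (Fin d) ℂ) ξ j = 0 := by
      rw [Matrix.one_apply]; split_ifs with hij
      · rw [hij]; ring
      · ring
    have h0 : h 0 = 0 := by
      simp only [h, v4, v6, vδ, hG0]
      linear_combination hone
    have h1 : deriv h 0 = 0 := by
      have hd := ((d4.mul d6).mul (((hasDerivAt_id (0 : ℂ)).mul dG').add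
        (dG.const_mul ((Λ ξ : ℂ) - 1)))).sub
        (((dG.const_mul ((Λ j : ℂ) - 1)).mul ((d4.pow 3).sub (dδ.const_mul 984))).add
          (dδ.mul dS))
      refine (HasDerivAt.deriv (f := h) hd).trans ?_
      rw [hS0, hCξ]
      simp only [Pi.mul_apply, Pi.add_apply, Pi.pow_apply, Pi.sub_apply, id, v4, v6, vδ, hG0, hG1]
      push_cast
      -- The constant 984 is chosen so that `E₄³ - 984Δ` and `E₄E₆` agree to first order: `3 · 240 -
      -- 984 = 240 - 504 = -264`. What remains in first order is cancelled by `C`.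
      linear_combination (-264 : ℂ) * hone
    have hO := (isBigO_sq_of_analyticAt ha h0 h1).comp_tendsto tendsto_qq
    have hO2 : (fun τ => qq τ * qq τ) =O[atImInfty] fun τ => qq τ * discriminant τ :=
      (Asymptotics.isBigO_refl _ _).mul qq_isBigO_discriminant
    have hO3 : (fun τ => h (qq τ)) =O[atImInfty] fun τ => qq τ * discriminant τ := by
      refine Asymptotics.IsBigO.trans ?_ hO2
      simpa [Function.comp_def, sq] using hO
    have hO4 := hO3.mul (Asymptotics.isBigO_refl (fun τ => (qq τ * discriminant τ)⁻¹) atImInfty)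
    refine (hO4.congr (fun τ => ?_) (fun τ => ?_) : _ =O[atImInfty] (1 : ℍ → ℂ)).trans
      (Asymptotics.isBigO_const_const _ one_ne_zero _)
    · have := discriminant_ne_zero τ
      have := qq_ne_zero τ
      rw [hh]; field_simp
    · exact mul_inv_cancel₀ (mul_ne_zero (qq_ne_zero τ) (discriminant_ne_zero τ))
  have hz := hYeq τ ξ
  rw [eq_zero_of_bounded hΛ hP hY hb] at hz
  simp only [Pi.zero_apply, mul_zero] at hz
  exact sub_eq_zero.mp hz.symm

/-! ### Calculus with `D` and the equation at the elliptic points -/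

/-- `f` is holomorphic with normalized derivative `f'`. -/
structure HasD (f f' : ℍ → ℂ) : Prop where
  mdiff : MDiff f
  eq : ∀ τ, D f τ = f' τ

theorem hasD_D {f : ℍ → ℂ} (hf : MDiff f) : HasD f (D f) := ⟨hf, fun _ => rfl⟩

namespace HasD

variable {f g f' g' : ℍ → ℂ}

theorem mul (hf : HasD f f') (hg : HasD g g') :
    HasD (fun τ => f τ * g τ) fun τ => f' τ * g τ + f τ * g' τ :=
  ⟨hf.mdiff.mul hg.mdiff, fun τ => by
    have := congrFun (normalizedDerivOfComplex_mul f g hf.mdiff hg.mdiff) τ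
    rw [← hf.eq, ← hg.eq]; exact this⟩

theorem add (hf : HasD f f') (hg : HasD g g') :
    HasD (fun τ => f τ + g τ) fun τ => f' τ + g' τ :=
  ⟨hf.mdiff.add hg.mdiff, fun τ => by
    have := congrFun (normalizedDerivOfComplex_add f g hf.mdiff hg.mdiff) τ
    rw [← hf.eq, ← hg.eq]; exact this⟩

theorem sub (hf : HasD f f') (hg : HasD g g') :
    HasD (fun τ => f τ - g τ) fun τ => f' τ - g' τ :=
  ⟨hf.mdiff.sub hg.mdiff, fun τ => by
    have := congrFun (normalizedDerivOfComplex_sub f g hf.mdiff hg.mdiff) τ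
    rw [← hf.eq, ← hg.eq]; exact this⟩

theorem const (c : ℂ) : HasD (fun _ => c) fun _ => 0 :=
  ⟨mdifferentiable_const, fun τ => congrFun (normalizedDerivOfComplex_const c) τ⟩

theorem const_mul (c : ℂ) (hf : HasD f f') : HasD (fun τ => c * f τ) fun τ => c * f' τ :=
  ⟨mdifferentiable_const.mul hf.mdiff, fun τ => by
    have := congrFun (normalizedDerivOfComplex_smul c f hf.mdiff) τ
    rw [← hf.eq]; exact this⟩

theorem pow (hf : HasD f f') (n : ℕ) :
    HasD (fun τ => f τ ^ n) fun τ => n * f τ ^ (n - 1) * f' τ :=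
  ⟨hf.mdiff.pow n, fun τ => by
    have := congrFun (normalizedDerivOfComplex_pow f n hf.mdiff) τ
    rw [← hf.eq]; exact this⟩

theorem sum {ι : Type*} (s : Finset ι) {f f' : ι → ℍ → ℂ} (h : ∀ i, HasD (f i) (f' i)) :
    HasD (fun τ => ∑ i ∈ s, f i τ) fun τ => ∑ i ∈ s, f' i τ := by
  classical
  induction s using Finset.induction_on with
  | empty => simpa using const 0
  | insert a s ha ih => simpa [Finset.sum_insert ha] using (h a).add ih

theorem eq_zero (hf : HasD f f') (h : ∀ τ, f τ = 0) (τ : ℍ) : f' τ = 0 := by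
  rw [← hf.eq, funext h]
  exact congrFun (normalizedDerivOfComplex_const 0) τ

theorem iterate (hf : MDiff f) : HasD (D f) (D (D f)) :=
  hasD_D (normalizedDerivOfComplex_mdifferentiable hf)

end HasD

theorem hasD_E₄ : HasD E₄ fun τ => 3⁻¹ * (E2 τ * E₄ τ - E₆ τ) :=
  ⟨mdiff_E₄, fun τ => by rw [D_E₄]; ring⟩

theorem hasD_E₆ : HasD E₆ fun τ => 2⁻¹ * (E2 τ * E₆ τ - E₄ τ * E₄ τ) :=
  ⟨mdiff_E₆, fun τ => by rw [D_E₆]; ring⟩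

theorem hasD_discriminant : HasD discriminant fun τ => E2 τ * discriminant τ :=
  ⟨mdiff_discriminant, D_discriminant⟩

section LocalAnalysis

variable {x y : ℍ → ℂ} {l : ℂ}

/-- The differentiated equation is kept in the exact shape produced by the `HasD` rules, so that it
can be differentiated once more. -/
theorem ode_deriv (hx : MDiff x) (hy : MDiff y) (h : ∀ τ, E₄ τ * E₆ τ * D x τ =
      l * x τ * (E₄ τ ^ 3 - 984 * discriminant τ) + discriminant τ * y τ) (τ : ℍ) :
    (((3⁻¹ * (E2 τ * E₄ τ - E₆ τ)) * E₆ τ +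
        E₄ τ * (2⁻¹ * (E2 τ * E₆ τ - E₄ τ * E₄ τ))) * D x τ + E₄ τ * E₆ τ * D (D x) τ) -
      (l * (D x τ * (E₄ τ * (E₄ τ * E₄ τ) - 984 * discriminant τ) +
        x τ * ((3⁻¹ * (E2 τ * E₄ τ - E₆ τ)) * (E₄ τ * E₄ τ) +
          E₄ τ * ((3⁻¹ * (E2 τ * E₄ τ - E₆ τ)) * E₄ τ + E₄ τ * (3⁻¹ * (E2 τ * E₄ τ - E₆ τ))) -
          984 * (E2 τ * discriminant τ))) +
        (E2 τ * discriminant τ * y τ + discriminant τ * D y τ)) = 0 :=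
  (((hasD_E₄.mul hasD_E₆).mul (.iterate hx)).sub
    ((((hasD_D hx).mul ((hasD_E₄.mul (hasD_E₄.mul hasD_E₄)).sub
      (hasD_discriminant.const_mul 984))).const_mul l).add
        (hasD_discriminant.mul (hasD_D hy)))).eq_zero (fun τ => by rw [h τ]; ring) τ

/-- Here `E₄³ = 1728Δ`, so `E₄³ - 984Δ = 744Δ`. The simple zero of `E₆` makes the differentiated
left side a multiple of `D x`, without `D² x`. -/
theorem ode_at_zero_E₆ (hx : MDiff x) (hy : MDiff y) (h : ∀ τ, E₄ τ * E₆ τ * D x τ =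
      l * x τ * (E₄ τ ^ 3 - 984 * discriminant τ) + discriminant τ * y τ)
    {τ : ℍ} (hτ : E₆ τ = 0) :
    y τ + 744 * l * x τ = 0 ∧ D y τ + 744 * l * D x τ = -864 * D x τ := by
  have hΔ := discriminant_ne_zero τ
  have h4 := E₄_cube_sub_E₆_sq τ
  have h1 := ode_deriv hx hy h τ
  have h0 := h τ
  rw [hτ] at h0 h4
  simp only [hτ] at h1
  have e0 : y τ + 744 * l * x τ = 0 := by
    refine mul_left_cancel₀ hΔ ?_
    linear_combination -h0 - l * x τ * h4
  refine ⟨e0, mul_left_cancel₀ hΔ ?_⟩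
  linear_combination -h1 - E2 τ * discriminant τ * e0 - (l * x τ * E2 τ + l * D x τ + D x τ / 2) * h4

/-- Here `E₄³ - 984Δ = -984Δ` and `E₆² = -1728Δ`. Two differentiations are needed because third
order vanishing is to be tested; the `E2` term comes from Ramanujan's identities. -/
theorem ode_at_zero_E₄ (hx : MDiff x) (hy : MDiff y) (h : ∀ τ, E₄ τ * E₆ τ * D x τ =
      l * x τ * (E₄ τ ^ 3 - 984 * discriminant τ) + discriminant τ * y τ)
    {τ : ℍ} (hτ : E₄ τ = 0) :
    y τ - 984 * l * x τ = 0 ∧ D y τ - 984 * l * D x τ = 576 * D x τ ∧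
      D (D y) τ - 984 * l * D (D x) τ = 1152 * D (D x) τ - 96 * E2 τ * D x τ := by
  have hΔ := discriminant_ne_zero τ
  have h4 := E₄_cube_sub_E₆_sq τ
  have h1 := ode_deriv hx hy h τ
  have hE2 : HasD E2 (D E2) := hasD_D E2_mdifferentiable
  have hx1 : HasD (D x) (D (D x)) := .iterate hx
  have hx2 : HasD (D (D x)) (D (D (D x))) := .iterate hx1.mdiff
  have hd4 := ((hE2.mul hasD_E₄).sub hasD_E₆).const_mul 3⁻¹
  have hd6 := ((hE2.mul hasD_E₆).sub (hasD_E₄.mul hasD_E₄)).const_mul 2⁻¹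
  have hdΔ := hE2.mul hasD_discriminant
  have h2 := ((((hd4.mul hasD_E₆).add (hasD_E₄.mul hd6)).mul hx1).add
    ((hasD_E₄.mul hasD_E₆).mul hx2)).sub
    ((((hx1.mul ((hasD_E₄.mul (hasD_E₄.mul hasD_E₄)).sub (hasD_discriminant.const_mul 984))).add
      ((hasD_D hx).mul (((hd4.mul (hasD_E₄.mul hasD_E₄)).add
        (hasD_E₄.mul ((hd4.mul hasD_E₄).add (hasD_E₄.mul hd4)))).sub
          (hdΔ.const_mul 984)))).const_mul l).add
      ((hdΔ.mul (hasD_D hy)).add (hasD_discriminant.mul (.iterate hy)))) |>.eq_zero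
        (ode_deriv hx hy h) τ
  have h0 := h τ
  rw [hτ] at h0 h4
  simp only [hτ] at h1 h2
  have e0 : y τ - 984 * l * x τ = 0 := by
    refine mul_left_cancel₀ hΔ ?_
    linear_combination -h0
  have e1 : D y τ - 984 * l * D x τ = 576 * D x τ := by
    refine mul_left_cancel₀ hΔ ?_
    linear_combination -h1 - E2 τ * discriminant τ * e0 + D x τ / 3 * h4
  refine ⟨e0, e1, mul_left_cancel₀ hΔ ?_⟩
  linear_combination -h2 - (D E2 τ * discriminant τ + E2 τ * E2 τ * discriminant τ) * e0
    - 2 * E2 τ * discriminant τ * e1 + (2 * D (D x) τ / 3 + 11 / 18 * E2 τ * D x τ) * h4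

end LocalAnalysis

/-! ### Division by `E₄` and `E₆` -/

/-- Division by a function with simple zeros. -/
theorem exists_differentiableOn_mul_eq {U : Set ℂ} (hU : IsOpen U) {f g : ℂ → ℂ}
    (hf : DifferentiableOn ℂ f U) (hg : DifferentiableOn ℂ g U)
    (hs : ∀ z ∈ U, g z = 0 → deriv g z ≠ 0 ∧ f z = 0) :
    ∃ h, DifferentiableOn ℂ h U ∧ ∀ z ∈ U, f z = g z * h z := by
  classical
  refine ⟨fun z => if g z = 0 then deriv f z / deriv g z else f z / g z, fun z hz => ?_,
    fun z hz => ?_⟩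
  · refine DifferentiableAt.differentiableWithinAt ?_
    have hfz := hf.analyticAt (hU.mem_nhds hz)
    have hgz := hg.analyticAt (hU.mem_nhds hz)
    by_cases h0 : g z = 0
    · obtain ⟨h1, h2⟩ := hs z hz h0
      have hdf : DifferentiableAt ℂ (dslope f z) z := by
        obtain ⟨p, hp⟩ := hfz
        exact AnalyticAt.differentiableAt ⟨_, hp.has_fpower_series_dslope_fslope⟩
      have hdg : DifferentiableAt ℂ (dslope g z) z := by
        obtain ⟨p, hp⟩ := hgz
        exact AnalyticAt.differentiableAt ⟨_, hp.has_fpower_series_dslope_fslope⟩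
      have hne : dslope g z z ≠ 0 := by rwa [dslope_same]
      -- At a common zero the factor `w - z` cancels, so the quotient is locally the quotient of the
      -- two `dslope`s, with value `f'(z)/g'(z)` at `z`.
      refine (hdf.div hdg hne).congr_of_eventuallyEq ?_
      filter_upwards [hdg.continuousAt.eventually_ne hne] with w hw
      have e1 : f w = (w - z) * dslope f z w := by
        have := sub_smul_dslope f z w
        simpa [h2] using this.symm
      have e2 : g w = (w - z) * dslope g z w := by
        have := sub_smul_dslope g z w
        simpa [h0] using this.symm
      rcases eq_or_ne w z with rfl | hwz
      · simp [h0]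
      · have hsub := sub_ne_zero.mpr hwz
        rw [if_neg (by rw [e2]; exact mul_ne_zero hsub hw), e1, e2]
        exact mul_div_mul_left _ _ hsub
    · refine (hfz.differentiableAt.div hgz.differentiableAt h0).congr_of_eventuallyEq ?_
      filter_upwards [hgz.continuousAt.eventually_ne h0] with w hw
      simp [hw]
  · by_cases h0 : g z = 0
    · simp [h0, (hs z hz h0).2]
    · simp only [if_neg h0]; field_simp

theorem exists_mdiff_mul_eq {f g : ℍ → ℂ} (hf : MDiff f) (hg : MDiff g)
    (hs : ∀ τ, g τ = 0 → D g τ ≠ 0 ∧ f τ = 0) : ∃ h : ℍ → ℂ, MDiff h ∧ ∀ τ, f τ = g τ * h τ := by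
  rw [UpperHalfPlane.mdifferentiable_iff] at hf hg
  obtain ⟨h, hh, he⟩ := exists_differentiableOn_mul_eq isOpen_upperHalfPlaneSet hf hg (by
    intro z hz h0
    have h1 : g ⟨z, hz⟩ = 0 := by simpa [ofComplex_apply_of_im_pos hz] using h0
    obtain ⟨h2, h3⟩ := hs _ h1
    exact ⟨fun h4 => h2 (by rw [normalizedDerivOfComplex]; exact mul_eq_zero_of_right _ h4),
      by simpa [ofComplex_apply_of_im_pos hz] using h3⟩)
  refine ⟨fun τ => h τ, ?_, fun τ => by simpa using he τ τ.im_pos⟩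
  rw [UpperHalfPlane.mdifferentiable_iff]
  exact hh.congr fun z hz => by simp [ofComplex_apply_of_im_pos hz]

/-- Components are divided separately. The transformation law of the quotient holds after
multiplication by `g`, and holomorphic functions on the upper half-plane have no zero divisors. -/
theorem IsVVForm.exists_eq_smul {k l : ℤ} {g : ℍ → ℂ} {f : ℍ → Fin d → ℂ}
    (hg : IsScalarForm k g) (hg0 : g ≠ 0) (hf : IsVVForm ρ l f)
    (hs : ∀ τ, g τ = 0 → D g τ ≠ 0) (hz : ∀ τ, g τ = 0 → f τ = 0) :
    ∃ h, IsVVForm ρ (l - k) h ∧ ∀ τ, f τ = g τ • h τ := by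
  have := fun ξ => exists_mdiff_mul_eq (hf.mdiff ξ) hg.mdiff fun τ h0 =>
    ⟨hs τ h0, congrFun (hz τ h0) ξ⟩
  choose h hh he using this
  have he' : ∀ τ, f τ = g τ • fun ξ => h ξ τ := fun τ => funext fun ξ => he ξ τ
  refine ⟨fun τ ξ => h ξ τ, ⟨hh, fun γ τ => ?_⟩, he'⟩
  funext ξ
  let u : ℍ → ℂ := fun τ => denom γ τ ^ (l - k) *
    ∑ ζ, (ρ γ : Matrix (Fin d) (Fin d) ℂ) ξ ζ * h ζ τ
  have hsum : ∀ s : Finset (Fin d), MDiff fun τ : ℍ =>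
      ∑ ζ ∈ s, (ρ γ : Matrix (Fin d) (Fin d) ℂ) ξ ζ * h ζ τ := fun s =>
    (HasD.sum s fun ζ => (hasD_D (hh ζ)).const_mul _).mdiff
  have hu : MDiff u := (mdifferentiable_denom_zpow _ _).mul (hsum _)
  have hγ : MDiff fun τ : ℍ => h ξ (γ • τ) :=
    (hh ξ).comp (mdifferentiable_smul (g := (γ : GL (Fin 2) ℝ)) (by simp))
  have hprod : g * (fun τ => h ξ (γ • τ) - u τ) = 0 := by
    funext τ
    have h1 := congrFun (hf.smul γ τ) ξ
    rw [he', he', hg.smul, Matrix.mulVec_smul] at h1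
    simp only [Pi.smul_apply, smul_eq_mul, Matrix.mulVec, dotProduct] at h1
    have h2 : denom γ τ ^ l = denom γ τ ^ k * denom γ τ ^ (l - k) := by
      rw [← zpow_add₀ (denom_ne_zero _ _)]; congr 1; ring
    rw [h2] at h1
    refine mul_left_cancel₀ (denom_zpow_ne_zero γ τ k) ?_
    simp only [Pi.mul_apply, Pi.zero_apply, u]
    linear_combination h1
  rcases (UpperHalfPlane.mul_eq_zero_iff hg.mdiff (hγ.sub hu)).mp hprod with h0 | h0
  · exact absurd h0 hg0
  · exact sub_eq_zero.mp (congrFun h0 τ)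

theorem IsVVForm.eq_zero_of_mem_orbit {k : ℤ} {f : ℍ → Fin d → ℂ} (hf : IsVVForm ρ k f)
    {σ τ : ℍ} (h0 : f σ = 0) (hτ : τ ∈ MulAction.orbit SL(2, ℤ) σ) : f τ = 0 := by
  obtain ⟨γ, rfl⟩ := hτ
  simp only
  rw [hf.smul, h0, Matrix.mulVec_zero, smul_zero]

theorem E₄_ne_zero' : (E₄ : ℍ → ℂ) ≠ 0 := fun h =>
  E_ne_zero (by norm_num : 3 ≤ 4) ⟨2, rfl⟩ (DFunLike.coe_injective h)

theorem E₆_ne_zero' : (E₆ : ℍ → ℂ) ≠ 0 := fun h =>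
  E_ne_zero (by norm_num : 3 ≤ 6) ⟨3, rfl⟩ (DFunLike.coe_injective h)

theorem E₄_ne_zero_of_E₆ {τ : ℍ} (h : E₆ τ = 0) : E₄ τ ≠ 0 := fun h4 => by
  have := E₄_cube_sub_E₆_sq τ
  rw [h, h4] at this
  exact discriminant_ne_zero τ (by linear_combination -this / 1728)

theorem D_E₆_ne_zero {τ : ℍ} (h : E₆ τ = 0) : D E₆ τ ≠ 0 := by
  rw [D_E₆, h]
  have := E₄_ne_zero_of_E₆ h
  simp [this]

theorem D_E₄_ne_zero {τ : ℍ} (h : E₄ τ = 0) : D E₄ τ ≠ 0 := by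
  rw [D_E₄, h]
  have : E₆ τ ≠ 0 := fun h6 => E₄_ne_zero_of_E₆ h6 h
  simp [this]

theorem IsVVForm.exists_eq_E₆_smul {l : ℤ} {f : ℍ → Fin d → ℂ} (hf : IsVVForm ρ l f)
    (h0 : f UpperHalfPlane.I = 0) : ∃ h, IsVVForm ρ (l - 6) h ∧ ∀ τ, f τ = E₆ τ • h τ :=
  hf.exists_eq_smul isScalarForm_E₆ E₆_ne_zero' (fun _ => D_E₆_ne_zero) fun _ h =>
    hf.eq_zero_of_mem_orbit h0 (E₆_eq_zero_iff.mp h)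

theorem IsVVForm.exists_eq_E₄_smul {l : ℤ} {f : ℍ → Fin d → ℂ} (hf : IsVVForm ρ l f)
    (h0 : f UpperHalfPlane.ρ = 0) : ∃ h, IsVVForm ρ (l - 4) h ∧ ∀ τ, f τ = E₄ τ • h τ :=
  hf.exists_eq_smul isScalarForm_E₄ E₄_ne_zero' (fun _ => D_E₄_ne_zero) fun _ h =>
    hf.eq_zero_of_mem_orbit h0 (E₄_eq_zero_iff.mp h)

/-! ### Bounds on the vanishing order of `Ξv` at the elliptic points -/

theorem mulVec_eq_sum_mul (M : Matrix (Fin d) (Fin d) ℂ) (v : Fin d → ℂ) (ξ : Fin d) :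
    (M *ᵥ v) ξ = ∑ j, v j * M ξ j := by
  simp only [Matrix.mulVec, dotProduct, mul_comm]

theorem isVVForm_mulVec (hP : PrincipalPartInvertible ρ Λ) (v : Fin d → ℂ) :
    IsVVForm ρ 0 fun τ => fundamentalMatrix ρ Λ τ *ᵥ v := by
  have h := IsVVForm.sum Finset.univ fun j =>
    (isVVForm_canonicalBasisVector (ρ := ρ) (Λ := Λ) hP j).const_smul (v j)
  convert! h using 2 with τ
  funext ξ
  rw [mulVec_eq_sum_mul]
  simp [fundamentalMatrix]

theorem tendsto_fundamentalMatrix (hΛ : IsExponentMatrix ρ Λ)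
    (hP : PrincipalPartInvertible ρ Λ) (ξ j : Fin d) :
    Tendsto (fun τ => qPow (1 - Λ ξ) τ * fundamentalMatrix ρ Λ τ ξ j) atImInfty
      (𝓝 ((1 : Matrix (Fin d) (Fin d) ℂ) ξ j)) := by
  obtain ⟨G, h1, h2, -⟩ := exists_isCuspHolo_fundamentalMatrix hΛ hP ξ j
  exact h2 ▸ h1.tendsto

theorem tendsto_mulVec (hΛ : IsExponentMatrix ρ Λ)
    (hP : PrincipalPartInvertible ρ Λ) (v : Fin d → ℂ) (ξ : Fin d) :
    Tendsto (fun τ => qPow (1 - Λ ξ) τ * (fundamentalMatrix ρ Λ τ *ᵥ v) ξ) atImInfty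
      (𝓝 (v ξ)) := by
  have h := tendsto_finsetSum Finset.univ fun j _ =>
    (tendsto_fundamentalMatrix hΛ hP ξ j).const_mul (v j)
  convert! h using 2 with τ
  · rw [mulVec_eq_sum_mul, Finset.mul_sum]
    exact Finset.sum_congr rfl fun _ _ => by ring
  · simp [Matrix.one_apply]

/-- Used with `g = E₆²` or `E₄³`. Since `q^{1-Λ} Ξv → v`, the factor `Δ` removes the pole and `Y`
vanishes by `eq_zero_of_bounded`; then `Ξv = 0`, and so is its limit `v`. -/
theorem eq_zero_of_smul_eq (hΛ : IsExponentMatrix ρ Λ) (hP : PrincipalPartInvertible ρ Λ)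
    {Y : ℍ → Fin d → ℂ} (hY : IsVVForm ρ 0 Y) {g : ℍ → ℂ} (hg : Tendsto g atImInfty (𝓝 1))
    {v : Fin d → ℂ} (h : ∀ τ, g τ • Y τ = discriminant τ • (fundamentalMatrix ρ Λ τ *ᵥ v)) :
    v = 0 := by
  have hb : ∀ ξ, IsBoundedAtImInfty fun τ => qPow (-Λ ξ) τ * Y τ ξ := by
    intro ξ
    have h1 : (fun τ => qq τ * (qPow (-Λ ξ) τ * Y τ ξ)) =O[atImInfty] qq := by
      have h2 := discriminant_isBigO_qq.mul ((tendsto_mulVec hΛ hP v ξ).isBigO_one ℂ)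
      have h3 := (hg.inv₀ one_ne_zero).isBigO_one ℂ
      refine (h3.mul h2).congr' ?_ (by simp)
      filter_upwards [hg.eventually_ne one_ne_zero] with τ hτ
      have h4 := congrFun (h τ) ξ
      simp only [Pi.smul_apply, smul_eq_mul] at h4
      rw [sub_eq_add_neg, qPow_add, qPow_one]
      field_simp
      linear_combination -(qq τ * qPow (-Λ ξ) τ) * h4
    have h5 := h1.mul (Asymptotics.isBigO_refl (fun τ => (qq τ)⁻¹) atImInfty)
    refine (h5.congr (fun τ => ?_) (fun τ => ?_) : _ =O[atImInfty] (1 : ℍ → ℂ)).trans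
      (Asymptotics.isBigO_const_const _ one_ne_zero _)
    · have := qq_ne_zero τ
      field_simp
    · exact mul_inv_cancel₀ (qq_ne_zero τ)
  have hY0 := eq_zero_of_bounded hΛ hP hY hb
  funext ξ
  refine tendsto_nhds_unique (tendsto_mulVec hΛ hP v ξ) ?_
  have h0 : ∀ τ, (fundamentalMatrix ρ Λ τ *ᵥ v) ξ = 0 := fun τ => by
    have := congrFun (h τ) ξ
    rw [hY0] at this
    simpa [discriminant_ne_zero τ] using this.symm
  simp [h0]

/-- The matrix of normalized derivatives of the fundamental matrix. -/
noncomputable def derivMatrix (ρ : SL(2, ℤ) →* GL (Fin d) ℂ) (Λ : Fin d → ℚ) (n : ℕ) (τ : ℍ) :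
    Matrix (Fin d) (Fin d) ℂ :=
  Matrix.of fun ξ j => (normalizedDerivOfComplex^[n] fun σ => fundamentalMatrix ρ Λ σ ξ j) τ

theorem mdiff_iterate {f : ℍ → ℂ} (hf : MDiff f) (n : ℕ) :
    MDiff (normalizedDerivOfComplex^[n] f) := by
  induction n with
  | zero => exact hf
  | succ n ih =>
    rw [Function.iterate_succ_apply']
    exact normalizedDerivOfComplex_mdifferentiable ih

theorem hasD_derivMatrix_mulVec (hP : PrincipalPartInvertible ρ Λ) (n : ℕ) (v : Fin d → ℂ)
    (ξ : Fin d) : HasD (fun τ => (derivMatrix ρ Λ n τ *ᵥ v) ξ)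
      fun τ => (derivMatrix ρ Λ (n + 1) τ *ᵥ v) ξ := by
  have h := HasD.sum Finset.univ fun j =>
    (hasD_D (mdiff_iterate (mdiff_fundamentalMatrix (ρ := ρ) (Λ := Λ) hP ξ j) n)).const_mul (v j)
  convert! h using 1 <;> funext τ
  · exact mulVec_eq_sum_mul _ _ _
  · simp only [← Function.iterate_succ_apply' normalizedDerivOfComplex]
    exact mulVec_eq_sum_mul _ _ _

/-- A combination of the columns of the fundamental matrix cannot vanish to second order at `i`. -/
theorem eq_zero_of_vanish_I (hΛ : IsExponentMatrix ρ Λ) (hP : PrincipalPartInvertible ρ Λ)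
    {v : Fin d → ℂ} (h0 : derivMatrix ρ Λ 0 UpperHalfPlane.I *ᵥ v = 0)
    (h1 : derivMatrix ρ Λ 1 UpperHalfPlane.I *ᵥ v = 0) : v = 0 := by
  obtain ⟨h, hh, he⟩ := (isVVForm_mulVec (Λ := Λ) hP v).exists_eq_E₆_smul h0
  -- The derivative of `E₆ h` at `i` is `D E₆ · h`, and the zero of `E₆` is simple.
  have hI : h UpperHalfPlane.I = 0 := by
    funext ξ
    have e1 := hasD_derivMatrix_mulVec (Λ := Λ) hP 0 v ξ
    have e2 := e1.sub (hasD_E₆.mul (hasD_D (hh.mdiff ξ)))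
    have e3 := e2.eq_zero (fun τ => sub_eq_zero.mpr (congrFun (he τ) ξ)) UpperHalfPlane.I
    rw [zero_add, h1, E₆_I] at e3
    have := E₄_ne_zero_of_E₆ E₆_I
    simpa [this] using e3
  obtain ⟨h', hh', he'⟩ := hh.exists_eq_E₆_smul hI
  refine eq_zero_of_smul_eq hΛ hP (IsVVForm.scalar_mul isScalarForm_discriminant hh')
    (by simpa using tendsto_E₆.mul tendsto_E₆) fun τ => ?_
  rw [he, he']; simp only [smul_smul]; ring_nf

/-- A combination of the columns of the fundamental matrix cannot vanish to third order at
`e^{2πi/3}`. -/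
theorem eq_zero_of_vanish_ρ (hΛ : IsExponentMatrix ρ Λ) (hP : PrincipalPartInvertible ρ Λ)
    {v : Fin d → ℂ} (h0 : derivMatrix ρ Λ 0 UpperHalfPlane.ρ *ᵥ v = 0)
    (h1 : derivMatrix ρ Λ 1 UpperHalfPlane.ρ *ᵥ v = 0)
    (h2 : derivMatrix ρ Λ 2 UpperHalfPlane.ρ *ᵥ v = 0) : v = 0 := by
  have h6 : E₆ UpperHalfPlane.ρ ≠ 0 := fun h6 => E₄_ne_zero_of_E₆ h6 E₄_ρ
  obtain ⟨h, hh, he⟩ := (isVVForm_mulVec (Λ := Λ) hP v).exists_eq_E₄_smul h0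
  have hI : h UpperHalfPlane.ρ = 0 := by
    funext ξ
    have e1 := hasD_derivMatrix_mulVec (Λ := Λ) hP 0 v ξ
    have e2 := e1.sub (hasD_E₄.mul (hasD_D (hh.mdiff ξ)))
    have e3 := e2.eq_zero (fun τ => sub_eq_zero.mpr (congrFun (he τ) ξ)) UpperHalfPlane.ρ
    rw [zero_add, h1, E₄_ρ] at e3
    simpa [h6] using e3
  obtain ⟨h', hh', he'⟩ := hh.exists_eq_E₄_smul hI
  -- The second derivative of `E₄² h'` at a zero of `E₄` is `2 (D E₄)² h'`.
  have hI' : h' UpperHalfPlane.ρ = 0 := by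
    funext ξ
    have e1 := hasD_derivMatrix_mulVec (Λ := Λ) hP 0 v ξ
    have e2 := hasD_derivMatrix_mulVec (Λ := Λ) hP 1 v ξ
    have f4 := hasD_D mdiff_E₄
    have f4' := HasD.iterate mdiff_E₄
    have g0 := hasD_D (hh'.mdiff ξ)
    have g1 := HasD.iterate (hh'.mdiff ξ)
    have k1 := (e1.sub ((f4.mul f4).mul g0)).eq_zero fun τ => by
      have := congrFun (he τ) ξ
      rw [he'] at this
      refine sub_eq_zero.mpr (this.trans ?_)
      simp only [Pi.smul_apply, smul_eq_mul]; ring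
    have k2 := (e2.sub ((((f4'.mul f4).add (f4.mul f4')).mul g0).add
      (((f4.mul f4).mul g1)))).eq_zero k1 UpperHalfPlane.ρ
    rw [E₄_ρ, h2] at k2
    simpa [D_E₄_ne_zero E₄_ρ] using k2
  obtain ⟨h'', hh'', he''⟩ := hh'.exists_eq_E₄_smul hI'
  refine eq_zero_of_smul_eq hΛ hP (IsVVForm.scalar_mul isScalarForm_discriminant hh'')
    (by simpa using tendsto_E₄.mul (tendsto_E₄.mul tendsto_E₄)) fun τ => ?_
  rw [he, he', he'']; simp only [smul_smul]; ring_nf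

/-! ### The spectra of `𝒜` and `ℬ` and their traces -/

theorem hasD_derivMatrix_mul (hP : PrincipalPartInvertible ρ Λ) (n : ℕ)
    (C : Matrix (Fin d) (Fin d) ℂ) (ξ j : Fin d) :
    HasD (fun τ => (derivMatrix ρ Λ n τ * C) ξ j) fun τ => (derivMatrix ρ Λ (n + 1) τ * C) ξ j :=
  hasD_derivMatrix_mulVec hP n (fun ζ => C ζ j) ξ

/-- Rewrites `𝒜` as `-(C + 744(Λ - 1))/864`, the combination occurring in `ode_at_zero_E₆`. -/
theorem mul_matrixA_apply (M : Matrix (Fin d) (Fin d) ℂ) (ξ j : Fin d) :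
    (M * matrixA ρ Λ) ξ j = -(1 / 864) *
      ((M * shiftedCharacteristicMatrix ρ Λ) ξ j + 744 * (Λ j - 1) * M ξ j) := by
  rw [matrixA, Matrix.mul_sub, Matrix.mul_smul, Matrix.mul_smul, Matrix.mul_sub, exponentMatrix]
  simp only [Matrix.sub_apply, Matrix.smul_apply, Matrix.mul_one, Matrix.mul_diagonal, smul_eq_mul]
  ring

theorem mul_matrixB_apply (M : Matrix (Fin d) (Fin d) ℂ) (ξ j : Fin d) :
    (M * matrixB ρ Λ) ξ j = (1 / 576) *
      ((M * shiftedCharacteristicMatrix ρ Λ) ξ j - 984 * (Λ j - 1) * M ξ j) := by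
  rw [matrixB, Matrix.mul_add, Matrix.mul_smul, Matrix.mul_smul, Matrix.mul_sub, exponentMatrix]
  simp only [Matrix.sub_apply, Matrix.add_apply, Matrix.smul_apply, Matrix.mul_one,
    Matrix.mul_diagonal, smul_eq_mul]
  ring

theorem derivMatrix_mul_matrixA (hΛ : IsExponentMatrix ρ Λ) (hP : PrincipalPartInvertible ρ Λ)
    {τ : ℍ} (hτ : E₆ τ = 0) :
    derivMatrix ρ Λ 0 τ * matrixA ρ Λ = 0 ∧
      derivMatrix ρ Λ 1 τ * matrixA ρ Λ = derivMatrix ρ Λ 1 τ := by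
  have key := fun ξ j => ode_at_zero_E₆ (mdiff_fundamentalMatrix hP ξ j)
    (hasD_derivMatrix_mul hP 0 (shiftedCharacteristicMatrix ρ Λ) ξ j).mdiff
    (fundamentalMatrix_ode hΛ hP ξ j) hτ
  simp only [(hasD_derivMatrix_mul hP 0 (shiftedCharacteristicMatrix ρ Λ) _ _).eq] at key
  refine ⟨?_, ?_⟩ <;> ext ξ j <;> rw [mul_matrixA_apply]
  · have h := (key ξ j).1
    change _ + _ * derivMatrix ρ Λ 0 τ ξ j = _ at h
    rw [h]; simp
  · have h := (key ξ j).2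
    change _ + _ * derivMatrix ρ Λ 1 τ ξ j = _ * derivMatrix ρ Λ 1 τ ξ j at h
    rw [h]; ring

theorem derivMatrix_mul_matrixB (hΛ : IsExponentMatrix ρ Λ) (hP : PrincipalPartInvertible ρ Λ)
    {τ : ℍ} (hτ : E₄ τ = 0) :
    derivMatrix ρ Λ 0 τ * matrixB ρ Λ = 0 ∧
      derivMatrix ρ Λ 1 τ * matrixB ρ Λ = derivMatrix ρ Λ 1 τ ∧
      derivMatrix ρ Λ 2 τ * matrixB ρ Λ =
        (2 : ℂ) • derivMatrix ρ Λ 2 τ - (E2 τ / 6) • derivMatrix ρ Λ 1 τ := by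
  have hC := fun n ξ j => hasD_derivMatrix_mul hP n (shiftedCharacteristicMatrix ρ Λ) ξ j
  have key := fun ξ j => ode_at_zero_E₄ (mdiff_fundamentalMatrix hP ξ j) (hC 0 ξ j).mdiff
    (fundamentalMatrix_ode hΛ hP ξ j) hτ
  simp only [funext (hC _ _ _).eq, (hC _ _ _).eq] at key
  refine ⟨?_, ?_, ?_⟩ <;> ext ξ j <;> rw [mul_matrixB_apply]
  · have h := (key ξ j).1
    change _ - _ * derivMatrix ρ Λ 0 τ ξ j = _ at h
    rw [h]; simp
  · have h := (key ξ j).2.1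
    change _ - _ * derivMatrix ρ Λ 1 τ ξ j = _ * derivMatrix ρ Λ 1 τ ξ j at h
    rw [h]; ring
  · have h := (key ξ j).2.2
    change _ - _ * derivMatrix ρ Λ 2 τ ξ j = _ * derivMatrix ρ Λ 2 τ ξ j -
      _ * derivMatrix ρ Λ 1 τ ξ j at h
    rw [h]; simp only [Matrix.sub_apply, Matrix.smul_apply, smul_eq_mul]; ring

theorem exists_mulVec_eq_smul_of_mem_roots {M : Matrix (Fin d) (Fin d) ℂ} {r : ℂ}
    (hr : r ∈ M.charpoly.roots) : ∃ v ≠ 0, M *ᵥ v = r • v := by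
  have h := (Polynomial.mem_roots'.mp hr).2
  rw [Polynomial.IsRoot, Matrix.eval_charpoly] at h
  obtain ⟨v, hv, h0⟩ := Matrix.exists_mulVec_eq_zero_iff.mpr h
  refine ⟨v, hv, ?_⟩
  rw [Matrix.sub_mulVec, sub_eq_zero] at h0
  rw [← h0, Matrix.scalar_apply]
  funext i
  simp [Matrix.mulVec_diagonal]

/-- For an eigenvector `v` the identities at `i` give `r Ξv = 0` and `(r - 1) DΞ v = 0`. Any other
`r` would make `Ξv` vanish to second order. -/
theorem roots_charpoly_matrixA (hΛ : IsExponentMatrix ρ Λ) (hP : PrincipalPartInvertible ρ Λ)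
    {r : ℂ} (hr : r ∈ (matrixA ρ Λ).charpoly.roots) : r = 0 ∨ r = 1 := by
  obtain ⟨v, hv, h⟩ := exists_mulVec_eq_smul_of_mem_roots hr
  by_contra! hne
  obtain ⟨h0, h1⟩ := derivMatrix_mul_matrixA hΛ hP E₆_I
  have e0 := congrArg (· *ᵥ v) h0
  have e1 := congrArg (· *ᵥ v) h1
  simp only [← Matrix.mulVec_mulVec, h, Matrix.mulVec_smul, Matrix.zero_mulVec] at e0 e1
  refine hv (eq_zero_of_vanish_I hΛ hP ?_ ?_)
  · exact (smul_eq_zero.mp e0).resolve_left hne.1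
  · replace e1 : (r - 1) • _ = _ := (sub_smul r 1 _).trans ((congrArg _ (one_smul ℂ _)).trans (sub_eq_zero.mpr e1))
    exact (smul_eq_zero.mp e1).resolve_left (sub_ne_zero.mpr hne.2)

/-- The `E2` term in the second derivative identity is harmless: for `r ≠ 1` the vector `DΞ v` is
already zero. -/
theorem roots_charpoly_matrixB (hΛ : IsExponentMatrix ρ Λ) (hP : PrincipalPartInvertible ρ Λ)
    {r : ℂ} (hr : r ∈ (matrixB ρ Λ).charpoly.roots) : r = 0 ∨ r = 1 ∨ r = 2 := by
  obtain ⟨v, hv, h⟩ := exists_mulVec_eq_smul_of_mem_roots hr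
  by_contra! hne
  obtain ⟨h0, h1, h2⟩ := derivMatrix_mul_matrixB hΛ hP E₄_ρ
  have e0 := congrArg (· *ᵥ v) h0
  have e1 := congrArg (· *ᵥ v) h1
  have e2 := congrArg (· *ᵥ v) h2
  simp only [← Matrix.mulVec_mulVec, h, Matrix.mulVec_smul, Matrix.zero_mulVec,
    Matrix.sub_mulVec, Matrix.smul_mulVec] at e0 e1 e2
  replace e1 : (r - 1) • _ = _ := (sub_smul r 1 _).trans ((congrArg _ (one_smul ℂ _)).trans (sub_eq_zero.mpr e1))
  replace e1 := (smul_eq_zero.mp e1).resolve_left (sub_ne_zero.mpr hne.2.1)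
  rw [e1, smul_zero, sub_zero, ← sub_eq_zero, ← sub_smul] at e2
  exact hv (eq_zero_of_vanish_ρ hΛ hP ((smul_eq_zero.mp e0).resolve_left hne.1) e1
    ((smul_eq_zero.mp e2).resolve_left (sub_ne_zero.mpr hne.2.2)))

theorem prod_map_neg_sub (x : ℂ) (s : Multiset ℂ) :
    (-1 : ℂ) ^ s.card * (s.map fun r => -x - r).prod = (s.map fun r => x + r).prod := by
  induction s using Multiset.induction_on with
  | empty => simp
  | cons a s ih =>
    rw [Multiset.card_cons, Multiset.map_cons, Multiset.map_cons, Multiset.prod_cons,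
      Multiset.prod_cons, ← ih]
    ring

/-- Follows from `x² - M² = (x - M)(x + M)` by evaluating at squares, which exhaust `ℂ`. It yields
`Tr M²` as the sum of squared eigenvalues without diagonalizing `M`. -/
theorem charpoly_sq_eq (M : Matrix (Fin d) (Fin d) ℂ) :
    (M ^ 2).charpoly = ((M.charpoly.roots.map (· ^ 2)).map fun r => Polynomial.X - .C r).prod := by
  have hs := (IsAlgClosed.splits M.charpoly).eq_prod_roots_of_monic M.charpoly_monic
  have hev : ∀ x : ℂ, (Matrix.scalar (Fin d) x - M).det =
      (M.charpoly.roots.map fun r => x - r).prod := fun x => by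
    rw [← Matrix.eval_charpoly]
    conv_lhs => rw [hs]
    rw [Polynomial.eval_multiset_prod, Multiset.map_map]
    simp
  refine Polynomial.funext fun y => ?_
  obtain ⟨x, rfl⟩ := IsAlgClosed.exists_pow_nat_eq y (by norm_num : 0 < 2)
  have hfac : Matrix.scalar (Fin d) (x ^ 2) - M ^ 2 =
      (Matrix.scalar (Fin d) x - M) * -(Matrix.scalar (Fin d) (-x) - M) := by
    have hc := (Matrix.scalar_commute x (fun r => Commute.all x r) M).eq
    rw [map_pow, map_neg]
    simp only [neg_sub, sub_neg_eq_add, mul_add, sub_mul, sq, hc]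
    abel
  have hcard : M.charpoly.roots.card = d := by
    rw [← (IsAlgClosed.splits M.charpoly).natDegree_eq_card_roots, M.charpoly_natDegree_eq_dim,
      Fintype.card_fin]
  have hneg : (-1 : ℂ) ^ d * (M.charpoly.roots.map fun r => -x - r).prod =
      (M.charpoly.roots.map fun r => x + r).prod := by
    have h := prod_map_neg_sub x M.charpoly.roots
    rwa [hcard] at h
  rw [Matrix.eval_charpoly, hfac, Matrix.det_mul, Matrix.det_neg, hev, hev, Fintype.card_fin, hneg,
    ← Multiset.prod_map_mul, Polynomial.eval_multiset_prod, Multiset.map_map, Multiset.map_map]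
  congr 1
  refine Multiset.map_congr rfl fun r _ => ?_
  simp; ring

theorem trace_sq_eq_sum (M : Matrix (Fin d) (Fin d) ℂ) :
    (M ^ 2).trace = (M.charpoly.roots.map (· ^ 2)).sum := by
  rw [Matrix.trace_eq_sum_roots_charpoly, charpoly_sq_eq, Polynomial.roots_multiset_prod_X_sub_C]

theorem sum_eq_of_mem {s : Multiset ℂ} (h : ∀ r ∈ s, r = 0 ∨ r = 1 ∨ r = 2) :
    s.sum = (s.count 1 : ℂ) + 2 * (s.count 2 : ℂ) ∧
      (s.map fun r : ℂ => r ^ 2).sum = (s.count 1 : ℂ) + 4 * (s.count 2 : ℂ) := by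
  induction s using Multiset.induction_on with
  | empty => simp
  | cons a s ih =>
    obtain ⟨h1, h2⟩ := ih fun r hr => h r (Multiset.mem_cons_of_mem hr)
    rw [Multiset.sum_cons, Multiset.map_cons, Multiset.sum_cons, h1, h2]
    rcases h a (Multiset.mem_cons_self a s) with rfl | rfl | rfl
    · rw [Multiset.count_cons_of_ne (by norm_num), Multiset.count_cons_of_ne (by norm_num)]
      constructor <;> ring
    · rw [Multiset.count_cons_self, Multiset.count_cons_of_ne (by norm_num)]
      push_cast
      constructor <;> ring
    · rw [Multiset.count_cons_self, Multiset.count_cons_of_ne (by norm_num)]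
      push_cast
      constructor <;> ring

theorem trace_matrixA (hΛ : IsExponentMatrix ρ Λ) (hP : PrincipalPartInvertible ρ Λ) :
    (matrixA ρ Λ).trace = sigAlpha ρ Λ := by
  have hr := fun r => roots_charpoly_matrixA hΛ hP (r := r)
  have h2 : (matrixA ρ Λ).charpoly.roots.count 2 = 0 :=
    Multiset.count_eq_zero_of_notMem fun h => by rcases hr 2 h with h | h <;> norm_num at h
  rw [Matrix.trace_eq_sum_roots_charpoly,
    (sum_eq_of_mem fun r h => (hr r h).imp_right Or.inl).1, h2, sigAlpha, Polynomial.count_roots]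
  simp

theorem trace_matrixB (hΛ : IsExponentMatrix ρ Λ) (hP : PrincipalPartInvertible ρ Λ) :
    (matrixB ρ Λ).trace = sigBeta₁ ρ Λ + 2 * sigBeta₂ ρ Λ ∧
      (matrixB ρ Λ ^ 2).trace = sigBeta₁ ρ Λ + 4 * sigBeta₂ ρ Λ := by
  obtain ⟨h1, h2⟩ := sum_eq_of_mem fun r => roots_charpoly_matrixB hΛ hP (r := r)
  rw [trace_sq_eq_sum, Matrix.trace_eq_sum_roots_charpoly, h1, h2, sigBeta₁, sigBeta₂,
    Polynomial.count_roots, Polynomial.count_roots]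
  exact ⟨rfl, rfl⟩

/-! ### The determinant -/

theorem HasD.prod {ι : Type*} [DecidableEq ι] (s : Finset ι) {f f' : ι → ℍ → ℂ}
    (h : ∀ i, HasD (f i) (f' i)) :
    HasD (fun τ => ∏ i ∈ s, f i τ) fun τ => ∑ i ∈ s, (∏ k ∈ s.erase i, f k τ) * f' i τ := by
  induction s using Finset.induction_on with
  | empty => simpa using HasD.const 1
  | insert a s ha ih =>
    have h2 := (h a).mul ih
    convert! h2 using 1 <;> funext τ
    · rw [Finset.prod_insert ha]
    · rw [Finset.sum_insert ha, Finset.erase_insert ha, Finset.mul_sum, mul_comm]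
      congr 1
      refine Finset.sum_congr rfl fun i hi => ?_
      rw [Finset.erase_insert_of_ne (by rintro rfl; exact ha hi),
        Finset.prod_insert (fun h => ha (Finset.mem_of_mem_erase h)), mul_assoc]

/-- Jacobi's formula, from the Leibniz expansion: differentiating one column at a time gives the
determinants that form the diagonal of `adj(M) M'`. -/
theorem HasD.det {M M' : ℍ → Matrix (Fin d) (Fin d) ℂ}
    (h : ∀ i j, HasD (fun τ => M τ i j) fun τ => M' τ i j) :
    HasD (fun τ => (M τ).det) fun τ => ((M τ).adjugate * M' τ).trace := by
  have h1 := HasD.sum Finset.univ fun σ : Equiv.Perm (Fin d) =>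
    (HasD.prod Finset.univ fun i => h (σ i) i).const_mul ((Equiv.Perm.sign σ : ℤ) : ℂ)
  convert! h1 using 1 <;> funext τ
  · exact Matrix.det_apply' _
  · have h2 : ∀ i, ((M τ).adjugate * M' τ) i i = ((M τ).updateCol i fun k => M' τ k i).det := by
      intro i
      rw [← Matrix.cramer_apply, Matrix.cramer_eq_adjugate_mulVec]
      rfl
    simp only [Matrix.trace, Matrix.diag_apply, h2, Matrix.det_apply', Finset.mul_sum]
    rw [Finset.sum_comm]
    refine Finset.sum_congr rfl fun σ _ => Finset.sum_congr rfl fun i _ => ?_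
    congr 1
    rw [← Finset.mul_prod_erase _ _ (Finset.mem_univ i), mul_comm, Matrix.updateCol_self]
    congr 1
    refine Finset.prod_congr rfl fun k hk => ?_
    rw [Matrix.updateCol_ne (Finset.ne_of_mem_erase hk)]

/-- The trace of the coefficient matrix of the equation for `Ξ`, with `Δ` eliminated through `1728Δ
= E₄³ - E₆²`. -/
theorem det_ode (hΛ : IsExponentMatrix ρ Λ) (hP : PrincipalPartInvertible ρ Λ) (τ : ℍ) :
    MDiff (fun τ => (fundamentalMatrix ρ Λ τ).det) ∧
    E₄ τ * E₆ τ * D (fun τ => (fundamentalMatrix ρ Λ τ).det) τ =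
      -((matrixA ρ Λ).trace / 2 * E₄ τ ^ 3 + (matrixB ρ Λ).trace / 3 * E₆ τ ^ 2) *
        (fundamentalMatrix ρ Λ τ).det := by
  have h := HasD.det fun i j => hasD_D (mdiff_fundamentalMatrix (ρ := ρ) (Λ := Λ) hP i j)
  refine ⟨h.mdiff, ?_⟩
  set M := fundamentalMatrix ρ Λ τ with hM
  set C := shiftedCharacteristicMatrix ρ Λ with hC
  have h1 : (E₄ τ * E₆ τ) • (Matrix.of fun i j => D (fun τ => fundamentalMatrix ρ Λ τ i j) τ) =
      M * ((E₄ τ ^ 3 - 984 * discriminant τ) • (exponentMatrix Λ - 1) + discriminant τ • C) := by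
    ext i j
    have := fundamentalMatrix_ode hΛ hP i j τ
    rw [exponentMatrix]
    simp only [Matrix.smul_apply, Matrix.of_apply, Matrix.mul_add, Matrix.mul_smul,
      Matrix.add_apply, smul_eq_mul, Matrix.mul_sub, Matrix.sub_apply, Matrix.mul_one,
      Matrix.mul_diagonal]
    rw [this]; ring
  have hA : (matrixA ρ Λ).trace = 31 / 36 * (d - (exponentMatrix Λ).trace) - 1 / 864 * C.trace := by
    simp [matrixA, hC, Matrix.trace_sub, Matrix.trace_smul]
  have hB : (matrixB ρ Λ).trace = 41 / 24 * (d - (exponentMatrix Λ).trace) + 1 / 576 * C.trace := by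
    simp [matrixB, hC, Matrix.trace_sub, Matrix.trace_smul]
  rw [h.eq]
  have h2 : E₄ τ * E₆ τ * (M.adjugate *
      (Matrix.of fun i j => D (fun τ => fundamentalMatrix ρ Λ τ i j) τ)).trace =
      M.det * ((E₄ τ ^ 3 - 984 * discriminant τ) * ((exponentMatrix Λ).trace - d) +
        discriminant τ * C.trace) := by
    rw [← smul_eq_mul, ← Matrix.trace_smul, ← Matrix.mul_smul, h1, ← mul_assoc,
      Matrix.adjugate_mul, Matrix.smul_mul, one_mul, Matrix.trace_smul, Matrix.trace_add,
      Matrix.trace_smul, Matrix.trace_smul, Matrix.trace_sub, Matrix.trace_one, Fintype.card_fin]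
    simp only [smul_eq_mul]
  refine h2.trans ?_
  rw [hA, hB]
  linear_combination -(M.det * (41 / 72 * (d - (exponentMatrix Λ).trace) + 1 / 1728 * C.trace)) *
    E₄_cube_sub_E₆_sq τ

theorem tendsto_etaH : Tendsto (fun τ => qPow (-(1 / 24)) τ * etaH τ) atImInfty (𝓝 1) := by
  have h1 := (differentiableOn_tprod_one_sub_pow.differentiableAt
    (Metric.isOpen_ball.mem_nhds (Metric.mem_ball_self one_pos))).continuousAt.tendsto.comp
    tendsto_qq
  simp only [ne_eq, Nat.add_eq_zero_iff, one_ne_zero, and_false, not_false_eq_true, zero_pow,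
    sub_zero, tprod_one] at h1
  refine h1.congr fun τ => ?_
  have h2 : Function.Periodic.qParam 24 (τ : ℂ) = qPow (1 / 24) τ := by
    rw [Function.Periodic.qParam, qPow]
    push_cast
    ring_nf
  rw [etaH, ModularForm.eta, h2, ← mul_assoc, qPow_neg_mul, one_mul]
  rfl

theorem qPow_pow (s : ℂ) (n : ℕ) (τ : ℍ) : qPow s τ ^ n = qPow (n * s) τ := by
  rw [qPow, qPow, ← Complex.exp_nat_mul]
  ring_nf

theorem qPow_sum {ι : Type*} (t : Finset ι) (s : ι → ℂ) (τ : ℍ) :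
    qPow (∑ i ∈ t, s i) τ = ∏ i ∈ t, qPow (s i) τ := by
  classical
  induction t using Finset.induction_on with
  | empty => exact qPow_zero τ
  | insert a t ha ih => rw [Finset.sum_insert ha, Finset.prod_insert ha, qPow_add, ih]

/-- With `k` twice the weight of `g`, the quotient has weight zero and its `E2` terms cancel in
Ramanujan's identities. -/
theorem hasD_div_etaH_pow {g g' : ℍ → ℂ} (hg : HasD g g') (k : ℕ) :
    HasD (fun τ => g τ / etaH τ ^ k) fun τ => (g' τ - k / 24 * E2 τ * g τ) / etaH τ ^ k := by
  have hη : HasD etaH fun τ => E2 τ * etaH τ / 24 := ⟨mdiff_etaH, D_etaH⟩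
  have h0 : ∀ τ, etaH τ ^ k ≠ 0 := fun τ => pow_ne_zero _ (etaH_ne_zero τ)
  have hm : MDiff fun τ => g τ / etaH τ ^ k := by
    simp only [div_eq_mul_inv]
    exact hg.mdiff.mul (mdiff_inv (hη.pow k).mdiff h0)
  refine ⟨hm, fun τ => ?_⟩
  have h1 := ((hasD_D hm).mul (hη.pow k)).eq τ
  have h2 : (fun τ => g τ / etaH τ ^ k * etaH τ ^ k) = g :=
    funext fun τ => div_mul_cancel₀ _ (h0 τ)
  rw [h2, hg.eq] at h1
  have h3 : (k : ℂ) * etaH τ ^ (k - 1) * (E2 τ * etaH τ / 24) =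
      k / 24 * E2 τ * etaH τ ^ k := by
    cases k with
    | zero => simp
    | succ k => rw [Nat.add_sub_cancel]; ring
  rw [h3] at h1
  have := h0 τ
  field_simp at h1 ⊢
  linear_combination -h1

theorem tendsto_div_etaH_pow {g : ℍ → ℂ} (hg : Tendsto g atImInfty (𝓝 1)) (k : ℕ) :
    Tendsto (fun τ => qPow (k / 24) τ * (g τ / etaH τ ^ k)) atImInfty (𝓝 1) := by
  have h := hg.div (tendsto_etaH.pow k) (by simp)
  rw [one_pow, div_one] at h
  refine h.congr fun τ => ?_
  have h1 := qPow_neg_mul (k / 24) τ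
  rw [Pi.div_apply, mul_pow, qPow_pow, show (k : ℂ) * -(1 / 24) = -(k / 24) by ring]
  have := qPow_ne_zero (-((k : ℂ) / 24)) τ
  have := etaH_ne_zero τ
  field_simp
  linear_combination -g τ * h1

/-- A vanishing Wronskian makes `f/g` constant near a point where `g ≠ 0`; the identity theorem
extends the relation to the whole half-plane. -/
theorem exists_eq_const_mul {f g : ℍ → ℂ} (hf : MDiff f) (hg : MDiff g) (hg0 : g ≠ 0)
    (h : ∀ τ, g τ * D f τ = f τ * D g τ) : ∃ c, ∀ τ, f τ = c * g τ := by
  obtain ⟨τ₀, h0⟩ := Function.ne_iff.mp hg0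
  have hf' := UpperHalfPlane.mdifferentiable_iff.mp hf
  have hg' := UpperHalfPlane.mdifferentiable_iff.mp hg
  have hev : ∀ᶠ z in 𝓝 (τ₀ : ℂ), z ∈ upperHalfPlaneSet ∧ (g ∘ ofComplex) z ≠ 0 := by
    refine Filter.Eventually.and (isOpen_upperHalfPlaneSet.mem_nhds τ₀.im_pos) ?_
    refine ((hg'.differentiableAt
      (isOpen_upperHalfPlaneSet.mem_nhds τ₀.im_pos)).continuousAt).eventually_ne ?_
    simpa using h0
  obtain ⟨r, hr, hball⟩ := Metric.eventually_nhds_iff_ball.mp hev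
  have hdf : ∀ z ∈ Metric.ball (τ₀ : ℂ) r, DifferentiableAt ℂ (f ∘ ofComplex) z := fun z hz =>
    hf'.differentiableAt (isOpen_upperHalfPlaneSet.mem_nhds (hball z hz).1)
  have hdg : ∀ z ∈ Metric.ball (τ₀ : ℂ) r, DifferentiableAt ℂ (g ∘ ofComplex) z := fun z hz =>
    hg'.differentiableAt (isOpen_upperHalfPlaneSet.mem_nhds (hball z hz).1)
  obtain ⟨c, hc⟩ := Metric.isOpen_ball.exists_is_const_of_deriv_eq_zero
    (f := f ∘ ofComplex / g ∘ ofComplex) (convex_ball (τ₀ : ℂ) r).isPreconnected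
    (fun z hz => ((hdf z hz).div (hdg z hz) (hball z hz).2).differentiableWithinAt) (by
      intro z hz
      have h1 := h ⟨z, (hball z hz).1⟩
      simp only [normalizedDerivOfComplex] at h1
      rw [deriv_div (hdf z hz) (hdg z hz) (hball z hz).2]
      refine div_eq_zero_iff.mpr (.inl ?_)
      have h2 : ofComplex z = ⟨z, (hball z hz).1⟩ := ofComplex_apply_of_im_pos (hball z hz).1
      simp only [Function.comp_apply, h2]
      refine mul_left_cancel₀ (inv_ne_zero two_pi_I_ne_zero) ?_
      linear_combination h1)
  refine ⟨c, fun τ => ?_⟩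
  have hF : MDiff fun τ => f τ - c * g τ := hf.sub (mdifferentiable_const.mul hg)
  have hz : ∀ᶠ σ in 𝓝 τ₀, f σ - c * g σ = 0 := by
    have hm : ∀ᶠ σ : ℍ in 𝓝 τ₀, (σ : ℂ) ∈ Metric.ball (τ₀ : ℂ) r :=
      UpperHalfPlane.continuous_coe.continuousAt.eventually (Metric.ball_mem_nhds _ hr)
    filter_upwards [hm] with σ hσ
    have h1 := hc σ hσ
    have h2 := (hball σ hσ).2
    simp only [Pi.div_apply, Function.comp_apply, ofComplex_apply] at h1 h2
    rw [div_eq_iff h2] at h1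
    rw [h1, sub_self]
  have := UpperHalfPlane.eq_zero_of_frequently hF
    (hz.filter_mono nhdsWithin_le_nhds).frequently
  exact sub_eq_zero.mp (congrFun this τ)

theorem HasD.pow_ode {f f' : ℍ → ℂ} (h : HasD f f') {a b : ℍ → ℂ}
    (hf : ∀ τ, a τ * f' τ = b τ * f τ) (n : ℕ) :
    MDiff (fun τ => f τ ^ n) ∧ ∀ τ, a τ * D (fun τ => f τ ^ n) τ = n * b τ * f τ ^ n := by
  refine ⟨(h.pow n).mdiff, fun τ => ?_⟩
  rw [(h.pow n).eq]
  cases n with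
  | zero => simp
  | succ n =>
    rw [Nat.add_sub_cancel]
    linear_combination (n + 1 : ℕ) * f τ ^ n * hf τ

theorem det_fundamentalMatrix (hΛ : IsExponentMatrix ρ Λ) (hP : PrincipalPartInvertible ρ Λ)
    (τ : ℍ) : (fundamentalMatrix ρ Λ τ).det =
      (E₄ τ / etaH τ ^ 8) ^ (sigBeta₁ ρ Λ + 2 * sigBeta₂ ρ Λ) *
        (E₆ τ / etaH τ ^ 12) ^ sigAlpha ρ Λ := by
  set n := sigBeta₁ ρ Λ + 2 * sigBeta₂ ρ Λ with hn
  set m := sigAlpha ρ Λ with hm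
  have hA : (matrixA ρ Λ).trace = m := trace_matrixA hΛ hP
  have hB : (matrixB ρ Λ).trace = n := by rw [(trace_matrixB hΛ hP).1, hn]; push_cast; rfl
  have hu := (hasD_div_etaH_pow hasD_E₄ 8).pow_ode (a := fun τ => E₄ τ * E₆ τ)
    (b := fun τ => -(E₆ τ ^ 2 / 3)) (fun τ => by push_cast; ring) n
  have hw := (hasD_div_etaH_pow hasD_E₆ 12).pow_ode (a := fun τ => E₄ τ * E₆ τ)
    (b := fun τ => -(E₄ τ ^ 3 / 2)) (fun τ => by push_cast; ring) m
  set R : ℍ → ℂ := fun τ => (E₄ τ / etaH τ ^ 8) ^ n * (E₆ τ / etaH τ ^ 12) ^ m with hR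
  have hRD := (hasD_D hu.1).mul (hasD_D hw.1)
  have hdet := det_ode hΛ hP
  -- In `Tr 𝒜 / 2 + Tr ℬ / 3` the contributions of `C` cancel and those of `1 - Λ` add up to `31/72
  -- + 41/72 = 1`. So both sides of the determinant formula have the same leading exponent in `q`.
  have hs : ∑ ξ, (1 - (Λ ξ : ℂ)) = n * (8 / 24) + m * (12 / 24) := by
    rw [← hA, ← hB]
    simp only [matrixA, matrixB, exponentMatrix, Matrix.trace_sub, Matrix.trace_add,
      Matrix.trace_smul, Matrix.trace_one, Matrix.trace_diagonal, Fintype.card_fin,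
      Finset.sum_sub_distrib, Finset.sum_const, Finset.card_univ, nsmul_eq_mul, smul_eq_mul]
    ring
  have hRlim : Tendsto (fun τ => qPow (∑ ξ, (1 - (Λ ξ : ℂ))) τ * R τ) atImInfty (𝓝 1) := by
    have h := ((tendsto_div_etaH_pow tendsto_E₄ 8).pow n).mul
      ((tendsto_div_etaH_pow tendsto_E₆ 12).pow m)
    rw [one_pow, one_pow, one_mul] at h
    refine h.congr fun τ => ?_
    rw [hs, qPow_add, mul_pow, mul_pow, qPow_pow, qPow_pow]
    push_cast
    ring
  have hdetlim : Tendsto (fun τ => qPow (∑ ξ, (1 - (Λ ξ : ℂ))) τ * (fundamentalMatrix ρ Λ τ).det)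
      atImInfty (𝓝 1) := by
    have h : Tendsto (fun τ => Matrix.of fun ξ j => qPow (1 - Λ ξ) τ * fundamentalMatrix ρ Λ τ ξ j)
        atImInfty (𝓝 (1 : Matrix (Fin d) (Fin d) ℂ)) :=
      tendsto_pi_nhds.mpr fun ξ => tendsto_pi_nhds.mpr fun j => tendsto_fundamentalMatrix hΛ hP ξ j
    have h2 := (continuous_id.matrix_det.tendsto (1 : Matrix (Fin d) (Fin d) ℂ)).comp h
    simp only [id, Matrix.det_one] at h2
    refine h2.congr fun τ => ?_
    rw [Function.comp_apply, Matrix.det_mul_column, qPow_sum]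
  have hR0 : R ≠ 0 := by
    intro h
    simp only [h, Pi.zero_apply, mul_zero] at hRlim
    exact zero_ne_one (tendsto_nhds_unique tendsto_const_nhds hRlim)
  -- The equation is singular at the elliptic points, so the Wronskian is first multiplied by
  -- `E₄E₆`, which is then cancelled among holomorphic functions.
  have hW : ∀ τ, R τ * D (fun τ => (fundamentalMatrix ρ Λ τ).det) τ =
      (fundamentalMatrix ρ Λ τ).det * D R τ := by
    have hd := normalizedDerivOfComplex_mdifferentiable (hdet UpperHalfPlane.I).1
    have hDR := normalizedDerivOfComplex_mdifferentiable hRD.mdiff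
    have hF := (hRD.mdiff.mul hd).sub ((hdet UpperHalfPlane.I).1.mul hDR)
    have h0 : (E₄ : ℍ → ℂ) * ((E₆ : ℍ → ℂ) * ((R * D (fun τ => (fundamentalMatrix ρ Λ τ).det)) -
        (fun τ => (fundamentalMatrix ρ Λ τ).det) * D R)) = (0 : ℍ → ℂ) := by
      funext τ
      simp only [Pi.mul_apply, Pi.sub_apply, Pi.zero_apply]
      rw [hRD.eq]
      have h1 := (hdet τ).2
      rw [hA, hB] at h1
      linear_combination R τ * h1 - (fundamentalMatrix ρ Λ τ).det *
        ((E₆ τ / etaH τ ^ 12) ^ m * hu.2 τ + (E₄ τ / etaH τ ^ 8) ^ n * hw.2 τ)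
    have h1 := (UpperHalfPlane.mul_eq_zero_iff mdiff_E₄ (mdiff_E₆.mul hF)).mp h0
    have h2 := (UpperHalfPlane.mul_eq_zero_iff mdiff_E₆ hF).mp (h1.resolve_left E₄_ne_zero')
    exact fun τ => sub_eq_zero.mp (congrFun (h2.resolve_left E₆_ne_zero') τ)
  obtain ⟨c, hc⟩ := exists_eq_const_mul (hdet UpperHalfPlane.I).1 hRD.mdiff hR0 hW
  have hc1 : c = 1 := by
    have h := hRlim.const_mul c
    rw [mul_one] at h
    refine tendsto_nhds_unique (h.congr fun τ => ?_) hdetlim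
    rw [hc τ]
    ring
  rw [hc τ, hc1, one_mul]

/-! ### Invertibility and stabilizers -/

theorem eq_one_of_smul_eq (hP : PrincipalPartInvertible ρ Λ) {γ : SL(2, ℤ)} {τ : ℍ}
    (hγ : γ • τ = τ) (hu : IsUnit (fundamentalMatrix ρ Λ τ)) : ρ γ = 1 := by
  have h : (ρ γ : Matrix (Fin d) (Fin d) ℂ) * fundamentalMatrix ρ Λ τ =
      1 * fundamentalMatrix ρ Λ τ := by
    ext ξ j
    have h1 := congrFun ((isVVForm_canonicalBasisVector hP j).smul γ τ) ξ
    rw [hγ, zpow_zero, one_smul] at h1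
    rw [one_mul]
    exact h1.symm
  exact Units.ext (hu.mul_right_cancel h)

/-- At `γ • σ` the stabilizer contains `γ δ γ⁻¹`, and triviality of `ρ` is unaffected by
conjugation. -/
theorem eq_one_of_conj_smul_eq (hP : PrincipalPartInvertible ρ Λ) {γ δ : SL(2, ℤ)} {σ : ℍ}
    (hσ : δ • σ = σ) (hu : IsUnit (fundamentalMatrix ρ Λ (γ • σ))) : ρ δ = 1 := by
  have h : (γ * δ * γ⁻¹) • γ • σ = γ • σ := by
    rw [mul_smul, inv_smul_smul, mul_smul, hσ]
  have h1 := eq_one_of_smul_eq hP h hu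
  rwa [map_mul, map_mul, map_inv, mul_inv_eq_one, mul_eq_left] at h1

theorem isUnit_fundamentalMatrix_iff (hΛ : IsExponentMatrix ρ Λ)
    (hP : PrincipalPartInvertible ρ Λ) (τ : ℍ) : IsUnit (fundamentalMatrix ρ Λ τ) ↔
      (E₄ τ = 0 → sigBeta₁ ρ Λ = 0 ∧ sigBeta₂ ρ Λ = 0) ∧ (E₆ τ = 0 → sigAlpha ρ Λ = 0) := by
  rw [Matrix.isUnit_iff_isUnit_det, isUnit_iff_ne_zero, det_fundamentalMatrix hΛ hP, ne_eq, mul_eq_zero,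
    pow_eq_zero_iff', pow_eq_zero_iff', div_eq_zero_iff, div_eq_zero_iff]
  have h8 := pow_ne_zero 8 (etaH_ne_zero τ)
  have h12 := pow_ne_zero 12 (etaH_ne_zero τ)
  have : sigBeta₁ ρ Λ + 2 * sigBeta₂ ρ Λ = 0 ↔ sigBeta₁ ρ Λ = 0 ∧ sigBeta₂ ρ Λ = 0 := by omega
  simp only [ne_eq, this, h8, h12, or_false]
  rw [not_or, not_and_not_right, not_and_not_right]

end VVMF

theorem mainTheorem5 {d : ℕ} (ρ : SL(2, ℤ) →* GL (Fin d) ℂ) (hρ : ρ (-1) = 1)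
    (Λ : Fin d → ℚ) (hΛ : VVMF.IsExponentMatrix ρ Λ)
    (hP : VVMF.PrincipalPartInvertible ρ Λ) :
    -- the multiplicities as traces
    ((VVMF.sigAlpha ρ Λ : ℂ) = (VVMF.matrixA ρ Λ).trace ∧
      (VVMF.sigBeta₁ ρ Λ : ℂ) =
        2 * (VVMF.matrixB ρ Λ).trace - (VVMF.matrixB ρ Λ ^ 2).trace ∧
      (VVMF.sigBeta₂ ρ Λ : ℂ) =
        ((VVMF.matrixB ρ Λ ^ 2).trace - (VVMF.matrixB ρ Λ).trace) / 2) ∧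
    -- the determinant formula
    (∀ τ : ℍ, (VVMF.fundamentalMatrix ρ Λ τ).det =
      (ModularForm.E₄ τ / VVMF.deltaThird τ) ^ (VVMF.sigBeta₁ ρ Λ + 2 * VVMF.sigBeta₂ ρ Λ) *
        (ModularForm.E₆ τ / VVMF.deltaHalf τ) ^ VVMF.sigAlpha ρ Λ) ∧
    -- invertibility away from the elliptic points
    (∀ τ : ℍ, τ ∉ VVMF.ellipticPointsI → τ ∉ VVMF.ellipticPointsRho →
      IsUnit (VVMF.fundamentalMatrix ρ Λ τ)) ∧
    -- behaviour at the elliptic points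
    (∀ τ ∈ VVMF.ellipticPointsI,
      (IsUnit (VVMF.fundamentalMatrix ρ Λ τ) ↔ VVMF.sigAlpha ρ Λ = 0) ∧
      (IsUnit (VVMF.fundamentalMatrix ρ Λ τ) → ρ ModularGroup.S = 1)) ∧
    (∀ τ ∈ VVMF.ellipticPointsRho,
      (IsUnit (VVMF.fundamentalMatrix ρ Λ τ) ↔
        VVMF.sigBeta₁ ρ Λ = 0 ∧ VVMF.sigBeta₂ ρ Λ = 0) ∧
      (IsUnit (VVMF.fundamentalMatrix ρ Λ τ) →
        ρ (ModularGroup.S * ModularGroup.T⁻¹) = 1)) := by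
  obtain ⟨hB1, hB2⟩ := VVMF.trace_matrixB hΛ hP
  refine ⟨⟨(VVMF.trace_matrixA hΛ hP).symm, ?_, ?_⟩, VVMF.det_fundamentalMatrix hΛ hP, ?_, ?_, ?_⟩
  · rw [hB1, hB2]; ring
  · rw [hB1, hB2]; ring
  · intro τ hI hr
    rw [VVMF.isUnit_fundamentalMatrix_iff hΛ hP, VVMF.E₄_eq_zero_iff, VVMF.E₆_eq_zero_iff]
    exact ⟨fun h => absurd h hr, fun h => absurd h hI⟩
  · intro τ hτ
    refine ⟨?_, ?_⟩
    · have h6 := VVMF.E₆_eq_zero_iff.mpr hτ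
      have h4 := VVMF.E₄_ne_zero_of_E₆ h6
      rw [VVMF.isUnit_fundamentalMatrix_iff hΛ hP]
      exact ⟨fun h => h.2 h6, fun h => ⟨fun h' => absurd h' h4, fun _ => h⟩⟩
    · obtain ⟨γ, rfl⟩ := hτ
      exact VVMF.eq_one_of_conj_smul_eq hP VVMF.S_smul_I
  · intro τ hτ
    refine ⟨?_, ?_⟩
    · have h4 := VVMF.E₄_eq_zero_iff.mpr hτ
      have h6 : ModularForm.E₆ τ ≠ 0 := fun h => VVMF.E₄_ne_zero_of_E₆ h h4
      rw [VVMF.isUnit_fundamentalMatrix_iff hΛ hP]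
      exact ⟨fun h => h.1 h4, fun h => ⟨fun _ => h, fun h' => absurd h' h6⟩⟩
    · obtain ⟨γ, rfl⟩ := hτ
      intro hu
      -- The fixed point of `S T⁻¹` is `T • ρ`, so the orbit point `γ • ρ` is written as `(γ T⁻¹) •
      -- (T • ρ)`.
      refine VVMF.eq_one_of_conj_smul_eq (γ := γ * ModularGroup.T⁻¹) hP VVMF.S_mul_T_inv_smul ?_
      rwa [mul_smul, inv_smul_smul]
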